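/- Let $\mathcal X\subseteq\mathbb R^d$ be compact, and suppose that at every point of $\mathcal X$ the tangent cone of $\mathcal X$ spans $\mathbb R^d$ (for instance, $\mathcal X$ is convex with non-empty interior), so that gradients of functions on $\mathcal X$ are uniquely determined. Let $c:\mathcal X\times\mathcal X\to[0,\infty)$ be symmetric and differentiable in its first argument, with constants $M_c,G_c,L_c$ such that for all $x,x',y\in\mathcal X$ $$c(x,y)\le M_c,\qquad |c(x,y)-c(x',y)|\le G_c\|x-x'\|,\qquad \|\nabla_1c(x,y)-\nabla_1c(x',y)\|\le L_c\|x-x'\|,$$ and set $c(x,y)=\infty$ if $x\notin\mathcal X$ or $y\notin\mathcal X$. Let $\mathcal H$ be a real reproducing kernel Hilbert space of functions on $\mathcal X$ whose kernel satisfies $k(x,y)\le D_k$ and $|k(x,y)-k(x',y)|\le G_k\|x-x'\|$ for some constants $D_k,G_k$, and let $\mathcal H^d$ carry the inner product $\langle\varphi,\psi\rangle_{\mathcal H^d}=\sum_{i=1}^d\langle\varphi_i,\psi_i\rangle_{\mathcal H}$. For $\gamma>0$ and probability measures $\mu,\nu$ on $\mathbb R^d$, let $$\mathrm{OT}_\gamma(\mu,\nu)=\inf_{\pi\in\Pi(\mu,\nu)}\int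 c\,d\pi+\gamma\,\mathrm{KL}(\pi\,\|\,\mu\otimes\nu)\in[0,\infty],$$ where $\Pi(\mu,\nu)$ is the set of couplings of $\mu$ and $\nu$. For probability measures $\alpha,\beta$ on $\mathcal X$, Sinkhorn potentials $(f_{\alpha,\beta},g_{\alpha,\beta})$ of $\mathrm{OT}_\gamma(\alpha,\beta)$ are continuous functions $f,g$ on $\mathcal X$ that maximize $$\int f\,d\alpha+\int g\,d\beta-\gamma\int\big(e^{(f(x)+g(y)-c(x,y))/\gamma}-1\big)\,d\alpha(x)\,d\beta(y)$$ over $C(\mathcal X)\times C(\mathcal X)$ and satisfy, at every point of $\mathcal X$, $f=-\gamma\log\int e^{(g(y)-c(\cdot,y))/\gamma}d\beta(y)$ and $g=-\gamma\log\int e^{(f(x)-c(x,\cdot))/\gamma}d\alpha(x)$. For $F:\mathcal H^d\to[0,\infty]$ with $F[\psi]<\infty$, an element $D\in\mathcal H^d$ is called a Fréchet derivative of $F$ at $\psi$ if for every $\xi\in\mathcal H^d$ $$\frac{F[\psi+\epsilon\xi]-F[\psi]}{\epsilon}\longrightarrow\langle D,\xi\rangle_{\mathcal H^d}\quad(\epsilon\to0,\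 \epsilon\ne0),$$ the limit being taken over those $\epsilon$ for which $F$ is finite on the segment from $\psi$ to $\psi+\epsilon\xi$ (no condition on $\xi$ if $0$ is not a limit point of such $\epsilon$). Fix probability measures $\alpha,\beta$ on $\mathcal X$, and for $\psi\in\mathcal H^d$ put $F_1[\psi]=\mathrm{OT}_\gamma((I+\psi)_\sharp\alpha,\beta)$ and $F_2[\psi]=\mathrm{OT}_\gamma((I+\psi)_\sharp\alpha,(I+\psi)_\sharp\alpha)$. Then Sinkhorn potentials of $\mathrm{OT}_\gamma(\alpha,\beta)$ and of $\mathrm{OT}_\gamma(\alpha,\alpha)$ exist, and for every choice of them $f_{\alpha,\beta}$ and $f_{\alpha,\alpha}$ are differentiable on $\mathcal X$, the integrals below converge for all $y\in\mathcal X$, and the functions $$DF_1[0](y)=\int_{\mathcal X}\nabla f_{\alpha,\beta}(x)\,k(x,y)\,d\alpha(x),\qquad DF_2[0](y)=2\int_{\mathcal X}\nabla f_{\alpha,\alpha}(x)\,k(x,y)\,d\alpha(x)$$ belong to $\mathcal H^d$ and are Fréchet derivatives at $0$ of $F_1$ and $F_2$ respectively. If moreover the support of $\alpha$ lies in the interior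 of $\mathcal X$, then $F_1$ and $F_2$ are finite in a neighbourhood of $0$ in $\mathcal H^d$, so that these limits are unrestricted two-sided limits in every direction $\xi\in\mathcal H^d$. -/

import Mathlib

open MeasureTheory Filter Topology
open scoped ENNReal

namespace SinkhornDescent

/-- The ambient Euclidean space `ℝ^d`. -/
abbrev E (d : ℕ) : Type := EuclideanSpace ℝ (Fin d)

variable {d : ℕ} {X : Set (E d)}

/-! ### Entropy-regularised optimal transport -/

/-- A cost `c : X × X → ℝ_+`, extended to `ℝ^d × ℝ^d` by the convention
`c(x, y) = ∞` if `x ∉ X` or `y ∉ X`. -/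
noncomputable def extCost (c : X → X → ℝ) (x y : E d) : ℝ≥0∞ :=
  open Classical in
  if h : x ∈ X ∧ y ∈ X then ENNReal.ofReal (c ⟨x, h.1⟩ ⟨y, h.2⟩) else ∞

/-- `Π(μ, ν)`: the couplings of `μ` and `ν`. -/
def couplings (μ ν : Measure (E d)) : Set (Measure (E d × E d)) :=
  {π | π.fst = μ ∧ π.snd = ν}

/-- `OT_γ(μ, ν) = inf_{π ∈ Π(μ, ν)} ⟨c, π⟩ + γ KL(π ‖ μ ⊗ ν)`, a number in `[0, ∞]`. -/
noncomputable def OT (γ : ℝ) (c : X → X → ℝ) (μ ν : Measure (E d)) : ℝ≥0∞ :=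
  ⨅ π ∈ couplings μ ν,
    (∫⁻ z, extCost c z.1 z.2 ∂π) + ENNReal.ofReal γ * InformationTheory.klDiv π (μ.prod ν)

/-- A measure on `X`, viewed as a measure on `ℝ^d` concentrated on `X`. -/
noncomputable def incl (α : Measure X) : Measure (E d) := α.map ((↑) : X → E d)

/-! ### Sinkhorn potentials -/

/-- The dual objective
`⟨f, α⟩ + ⟨g, β⟩ - γ ⟨exp((f ⊕ g - c)/γ) - 1, α ⊗ β⟩`. -/
noncomputable def dualObjective (γ : ℝ) (c : X → X → ℝ) (α β : Measure X)
    (p : C(X, ℝ) × C(X, ℝ)) : ℝ :=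
  (∫ x, p.1 x ∂α) + (∫ y, p.2 y ∂β)
    - γ * ∫ z : X × X, (Real.exp ((p.1 z.1 + p.2 z.2 - c z.1 z.2) / γ) - 1) ∂(α.prod β)

/-- The Sinkhorn mapping `A(f, α)(y) = -γ log ∫ exp((f(x) - c(x, y))/γ) dα(x)`. -/
noncomputable def sinkhornMap (γ : ℝ) (c : X → X → ℝ) (f : X → ℝ) (α : Measure X) (y : X) : ℝ :=
  -γ * Real.log (∫ x, Real.exp ((f x - c x y) / γ) ∂α)

/-- `(f, g)` are Sinkhorn potentials of `OT_γ(α, β)`: a maximiser of the dual problem over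
`C(X) × C(X)`, extended from the supports of `α` and `β` to all of `X` by the optimality
conditions `f = A(g, β)` and `g = A(f, α)`. (Maximality alone determines `f` only `α`-a.e.) -/
structure IsSinkhornPotentials (γ : ℝ) (c : X → X → ℝ) (α β : Measure X)
    (f g : C(X, ℝ)) : Prop where
  isMax : ∀ p : C(X, ℝ) × C(X, ℝ), dualObjective γ c α β p ≤ dualObjective γ c α β (f, g)
  left_eq : ∀ x, f x = sinkhornMap γ c g β x
  right_eq : ∀ y, g y = sinkhornMap γ c f α y

/-! ### Gradients of functions on `X` -/

/-- Extension by zero. Only used below for derivatives within `X`, at points of `X`, which do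
not depend on the values outside `X`. -/
noncomputable def extZero (f : X → ℝ) : E d → ℝ := Function.extend ((↑) : X → E d) f 0

/-- `f : X → ℝ` is differentiable at `x ∈ X`. -/
def DiffAt (f : X → ℝ) (x : X) : Prop := DifferentiableWithinAt ℝ (extZero f) X x

/-- The gradient at `x ∈ X` of a function `f : X → ℝ`. -/
noncomputable def grad (f : X → ℝ) (x : X) : E d := gradientWithin (extZero f) X x

/-- The ground cost is nonnegative and symmetric, bounded by `Mc`, `Gc`-Lipschitz and
`Lc`-smooth in its first argument. -/
structure CostAssumption (c : X → X → ℝ) (Mc Gc Lc : ℝ) : Prop where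
  nonneg : ∀ x y, 0 ≤ c x y
  symm : ∀ x y, c x y = c y x
  bounded : ∀ x y, c x y ≤ Mc
  lipschitz : ∀ x x' y, |c x y - c x' y| ≤ Gc * ‖(x : E d) - x'‖
  diff : ∀ x y, DiffAt (fun z => c z y) x
  smooth : ∀ x x' y,
    ‖grad (fun z => c z y) x - grad (fun z => c z y) x'‖ ≤ Lc * ‖(x : E d) - x'‖

/-! ### The reproducing kernel Hilbert space -/

section RKHSPart

variable (H : Type*) [NormedAddCommGroup H] [InnerProductSpace ℝ H] [CompleteSpace H]
  [RKHS ℝ H X ℝ]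

/-- The (scalar) reproducing kernel `k : X × X → ℝ` of `H`. -/
noncomputable def ker (x y : X) : ℝ := RKHS.kernel H x y 1

/-- The kernel is bounded by `Dk` and `Gk`-Lipschitz in its first argument. -/
structure KernelAssumption (Dk Gk : ℝ) : Prop where
  bounded : ∀ x y : X, ker H x y ≤ Dk
  lipschitz : ∀ x x' y : X, |ker H x y - ker H x' y| ≤ Gk * ‖(x : E d) - x'‖

/-- `H^d`, with inner product `⟨φ, ψ⟩ = ∑ i, ⟨φ_i, ψ_i⟩_H`. -/
abbrev Hd (d : ℕ) : Type _ := PiLp 2 (fun _ : Fin d => H)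

variable {H}

/-- The value `ψ(x) ∈ ℝ^d` of `ψ ∈ H^d` at `x ∈ X`. -/
noncomputable def eval (ψ : Hd H d) (x : X) : E d :=
  WithLp.toLp 2 (fun i => (ψ i : X → ℝ) x)

/-- The push-forward `(I + ψ)_♯ α`, a measure on `ℝ^d`. -/
noncomputable def push (ψ : Hd H d) (α : Measure X) : Measure (E d) :=
  α.map (fun x : X => (x : E d) + eval ψ x)

/-- `F₁[ψ] = OT_γ((I + ψ)_♯ α, β)`. -/
noncomputable def F₁ (γ : ℝ) (c : X → X → ℝ) (α β : Measure X) (ψ : Hd H d) : ℝ≥0∞ :=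
  OT γ c (push ψ α) (incl β)

/-- `F₂[ψ] = OT_γ((I + ψ)_♯ α, (I + ψ)_♯ α)`. -/
noncomputable def F₂ (γ : ℝ) (c : X → X → ℝ) (α : Measure X) (ψ : Hd H d) : ℝ≥0∞ :=
  OT γ c (push ψ α) (push ψ α)

end RKHSPart

/-- The Fréchet derivative, in the sense used for functionals on `H^d`: `D` is the derivative of
`F` at `ψ` if for every direction `ξ`, `(F[ψ + ε ξ] - F[ψ]) / ε → ⟨D, ξ⟩` as `ε → 0`, `ε ≠ 0`.
The functional may take the value `∞`; the limit is taken in the interval of those `ε` for which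
`F` is finite on the segment from `ψ` to `ψ + ε ξ`. It is the ordinary two-sided limit if `F` is
finite on the line near `ψ`, and a one-sided limit if `F` is finite on one side only. -/
structure HasDerivRKHS {V : Type*} [NormedAddCommGroup V] [InnerProductSpace ℝ V]
    (F : V → ℝ≥0∞) (D ψ : V) : Prop where
  finite : F ψ ≠ ∞
  tendsto : ∀ ξ : V,
    Tendsto (fun ε : ℝ => ((F (ψ + ε • ξ)).toReal - (F ψ).toReal) / ε)
      (𝓝[{ε : ℝ | ε ≠ 0 ∧ ∀ s ∈ Set.uIcc 0 ε, F (ψ + s • ξ) ≠ ∞}] 0)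
      (𝓝 (inner ℝ D ξ))

end SinkhornDescent

/-! The derivative comes from an envelope argument that needs no stability of the potentials under
perturbation of the measures. Let `f`, `g` solve the Schrödinger system for `α`, `β`, and displace
the marginals by `move u s` and `move v s`. Weak duality, tested on the unperturbed pair `(f, g)`,
bounds the transport cost from below. The push-forward of the unperturbed optimal plan, of density
`gibbs`, bounds it from above, since KL does not increase under maps. Both bounds equal `∫ f ∂α + ∫
g ∂β` at `s = 0`. They also have the same right derivative there: differentiating the Schrödinger
equation shows that `grad f x` is the average of `∇₁ c (x, ·)` against the plan, and because the
plan has marginals `α` and `β` the exponential term of the dual contributes nothing to first order.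
Hence the cost between them is right-differentiable (`hasDerivWithinAt_OT_move`).

Potentials are found by maximising a semi-dual functional over normalised Lipschitz functions
(`exists_sinkhorn_fixedPoint`); a solution of the system is a dual maximiser because its plan closes
the duality gap.

For `F₁` the second field is zero. For `F₂` both fields agree, and the two potentials of `α` with
itself differ by a constant, whence the factor 2. Finiteness of the functional on a segment forces
almost every point to stay in `X` along it, so the envelope theorem applies; limits from the left
follow by reversing the direction. The reproducing property turns `∫ ⟨grad f, ξ⟩ ∂α` into an inner
product in `Hd H d`. -/

namespace SinkhornDescent

variable {d : ℕ} {X : Set (E d)}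

/-! ### Joint continuity of the cost. -/

section Cost

variable {c : X → X → ℝ} {Mc Gc Lc : ℝ}

lemma CostAssumption.lipschitzWith (hc : CostAssumption c Mc Gc Lc) (y : X) :
    LipschitzWith |Gc|.toNNReal (fun x => c x y) := by
  refine LipschitzWith.of_dist_le_mul fun x x' => ?_
  rw [Real.coe_toNNReal _ (abs_nonneg _), Real.dist_eq, Subtype.dist_eq, dist_eq_norm]
  exact (hc.lipschitz x x' y).trans (mul_le_mul_of_nonneg_right (le_abs_self _) (norm_nonneg _))

lemma CostAssumption.abs_sub_le (hc : CostAssumption c Mc Gc Lc) (x x' y : X) :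
    |c x y - c x' y| ≤ |Gc| * dist x x' := by
  have := (hc.lipschitzWith y).dist_le_mul x x'
  rwa [Real.coe_toNNReal _ (abs_nonneg _), Real.dist_eq] at this

lemma CostAssumption.continuous (hc : CostAssumption c Mc Gc Lc) :
    Continuous (fun z : X × X => c z.1 z.2) :=
  (LipschitzWith.uncurry (f := c) (fun y => hc.lipschitzWith y)
    (fun x => (funext fun y => hc.symm y x : (fun y => c y x) = c x) ▸ hc.lipschitzWith x)).continuous

end Cost

/-! ### The Sinkhorn mapping and the Schrödinger system. -/

section SinkhornMap

variable {c : X → X → ℝ} {γ : ℝ}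

lemma integrable_of_continuous {Y : Type*} [TopologicalSpace Y] [CompactSpace Y]
    [MeasurableSpace Y] [OpensMeasurableSpace Y] {F : Type*} [NormedAddCommGroup F]
    [SecondCountableTopologyEither Y F] {μ : Measure Y} [IsFiniteMeasure μ] {h : Y → F}
    (hh : Continuous h) : Integrable h μ := by
  obtain ⟨C, hC⟩ := isCompact_univ.exists_bound_of_continuousOn hh.continuousOn
  exact Integrable.of_bound hh.aestronglyMeasurable C (ae_of_all _ fun x => hC x trivial)

/-- The Gibbs kernel `exp ((f ⊕ g - c) / γ)`. -/
noncomputable def gibbs (γ : ℝ) (c : X → X → ℝ) (f g : X → ℝ) (z : X × X) : ℝ :=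
  Real.exp ((f z.1 + g z.2 - c z.1 z.2) / γ)

lemma gibbs_pos {f g : X → ℝ} (z : X × X) : 0 < gibbs γ c f g z := Real.exp_pos _

lemma continuous_gibbs (hc : Continuous (fun z : X × X => c z.1 z.2)) {f g : X → ℝ}
    (hf : Continuous f) (hg : Continuous g) : Continuous (gibbs γ c f g) := by
  unfold gibbs; fun_prop

lemma gibbs_swap (hs : ∀ x y, c x y = c y x) {f g : X → ℝ} (z : X × X) :
    gibbs γ c f g z.swap = gibbs γ c g f z := by
  simp only [gibbs, Prod.fst_swap, Prod.snd_swap, hs z.1 z.2, add_comm]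

lemma continuous_exp_sub_cost (hc : Continuous (fun z : X × X => c z.1 z.2)) {f : X → ℝ}
    (hf : Continuous f) (y : X) : Continuous (fun x => Real.exp ((f x - c x y) / γ)) := by
  have : Continuous (fun x => c x y) := hc.comp (by fun_prop : Continuous fun x : X => (x, y))
  fun_prop

/-- Arzelà–Ascoli: the normalisation confines the values at `x` to an interval of radius `G * dist x
x₀`, and the common Lipschitz constant gives equicontinuity. -/
lemma isCompact_lipschitz_normalized (G : NNReal) (x₀ : X) :
    IsCompact {f : C(X, ℝ) | LipschitzWith G f ∧ f x₀ = 0} := by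
  apply ArzelaAscoli.isCompact_of_equicontinuous
  · have himg : ContinuousMap.toFun '' {f : C(X, ℝ) | LipschitzWith G f ∧ f x₀ = 0} =
        {h : X → ℝ | (∀ x y, |h x - h y| ≤ G * dist x y) ∧ h x₀ = 0} := by
      ext h
      constructor
      · rintro ⟨f, ⟨hf, hf0⟩, rfl⟩
        exact ⟨fun x y => hf.dist_le_mul x y, hf0⟩
      · rintro ⟨h1, h2⟩
        have hl : LipschitzWith G h := LipschitzWith.of_dist_le_mul h1
        exact ⟨⟨h, hl.continuous⟩, ⟨hl, h2⟩, rfl⟩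
    rw [himg]
    refine IsCompact.of_isClosed_subset (isCompact_univ_pi fun x : X =>
      isCompact_Icc (a := -(G * dist x x₀)) (b := G * dist x x₀)) ?_ ?_
    · simp only [Set.ofPred_and, Set.ofPred_forall]
      refine IsClosed.inter (isClosed_iInter fun x => isClosed_iInter fun y => ?_) ?_
      · exact isClosed_le (by fun_prop) continuous_const
      · exact isClosed_eq (by fun_prop) continuous_const
    · rintro h ⟨h1, h2⟩ x -
      have := h1 x x₀
      rw [h2, sub_zero] at this
      exact abs_le.1 this
  · refine (LipschitzWith.uniformEquicontinuous _ G fun f => ?_).equicontinuous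
    exact f.2.1

variable [CompactSpace X] (α β : Measure X) [IsProbabilityMeasure α] [IsProbabilityMeasure β]

lemma integral_exp_sub_cost_pos (hc : Continuous (fun z : X × X => c z.1 z.2)) {f : X → ℝ}
    (hf : Continuous f) (y : X) : 0 < ∫ x, Real.exp ((f x - c x y) / γ) ∂α :=
  integral_exp_pos (integrable_of_continuous (continuous_exp_sub_cost hc hf y))

-- The soft minimum is monotone and commutes with adding constants. Taking `f = f'`, or `y = y'`, or
-- a constant shift yields its Lipschitz bound, its nonexpansiveness and its equivariance.
variable {α} in
lemma sinkhornMap_le (hγ : 0 < γ) (hc : Continuous (fun z : X × X => c z.1 z.2))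
    {f f' : X → ℝ} (hf : Continuous f) (hf' : Continuous f') {y y' : X} {L : ℝ}
    (h : ∀ x, f x - c x y ≤ f' x - c x y' + L) :
    sinkhornMap γ c f' α y' ≤ sinkhornMap γ c f α y + L := by
  have h1 : ∫ x, Real.exp ((f x - c x y) / γ) ∂α
      ≤ Real.exp (L / γ) * ∫ x, Real.exp ((f' x - c x y') / γ) ∂α := by
    rw [← integral_const_mul]
    refine integral_mono (integrable_of_continuous (continuous_exp_sub_cost hc hf y))
      ((integrable_of_continuous (continuous_exp_sub_cost hc hf' y')).const_mul _) fun x => ?_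
    simp only [← Real.exp_add, Real.exp_le_exp, ← add_div]
    gcongr
    linarith [h x]
  have h2 := Real.log_le_log (integral_exp_sub_cost_pos α hc hf y) h1
  rw [Real.log_mul (Real.exp_pos _).ne' (integral_exp_sub_cost_pos α hc hf' y').ne',
    Real.log_exp] at h2
  have h3 := mul_le_mul_of_nonneg_left h2 hγ.le
  rw [mul_add, mul_div_cancel₀ _ hγ.ne'] at h3
  simp only [sinkhornMap]
  linarith

variable {α} in
lemma sinkhornMap_sub_le {Mc Gc Lc : ℝ} (hγ : 0 < γ) (hc : CostAssumption c Mc Gc Lc)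
    {f : X → ℝ} (hf : Continuous f) (y y' : X) :
    |sinkhornMap γ c f α y - sinkhornMap γ c f α y'| ≤ |Gc| * dist y y' := by
  have key : ∀ y y', sinkhornMap γ c f α y ≤ sinkhornMap γ c f α y' + |Gc| * dist y y' := by
    intro y y'
    refine sinkhornMap_le hγ hc.continuous hf hf fun x => ?_
    have := (abs_le.1 (hc.abs_sub_le y y' x)).2
    rw [hc.symm x y, hc.symm x y']
    linarith
  rw [abs_le]
  constructor
  · have := key y' y
    rw [dist_comm] at this
    linarith
  · linarith [key y y']

lemma exp_neg_sinkhornMap (hγ : 0 < γ) (hc : Continuous (fun z : X × X => c z.1 z.2))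
    {f : X → ℝ} (hf : Continuous f) (y : X) :
    Real.exp (-sinkhornMap γ c f α y / γ) = ∫ x, Real.exp ((f x - c x y) / γ) ∂α := by
  have : -sinkhornMap γ c f α y / γ = Real.log (∫ x, Real.exp ((f x - c x y) / γ) ∂α) := by
    simp only [sinkhornMap]
    field_simp
  rw [this, Real.exp_log (integral_exp_sub_cost_pos α hc hf y)]

/-- No equation is imposed on `g`: the marginal density is 1 exactly where `g` equals the Sinkhorn
image of `f`. The existence proof uses the formula off the fixed point. -/
lemma integral_gibbs_left (hγ : 0 < γ) (hc : Continuous (fun z : X × X => c z.1 z.2))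
    {f : X → ℝ} (hf : Continuous f) (g : X → ℝ) (y : X) :
    ∫ x, gibbs γ c f g (x, y) ∂α = Real.exp ((g y - sinkhornMap γ c f α y) / γ) := by
  rw [sub_eq_add_neg, add_div, Real.exp_add, exp_neg_sinkhornMap α hγ hc hf,
    ← integral_const_mul]
  refine integral_congr_ae (ae_of_all _ fun x => ?_)
  simp only [gibbs, ← Real.exp_add]
  ring_nf

lemma integral_gibbs_right (hγ : 0 < γ) (hc : Continuous (fun z : X × X => c z.1 z.2))
    (hs : ∀ x y, c x y = c y x) (f : X → ℝ) {g : X → ℝ} (hg : Continuous g) (x : X) :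
    ∫ y, gibbs γ c f g (x, y) ∂β = Real.exp ((f x - sinkhornMap γ c g β x) / γ) := by
  rw [← integral_gibbs_left β hγ hc hg]
  exact integral_congr_ae (ae_of_all _ fun y => gibbs_swap hs (y, x))

lemma integral_prod_gibbs_left (hγ : 0 < γ) (hc : Continuous (fun z : X × X => c z.1 z.2))
    {f g : X → ℝ} (hf : Continuous f) (hg : Continuous g) :
    ∫ z, gibbs γ c f g z ∂(α.prod β) =
      ∫ y, Real.exp ((g y - sinkhornMap γ c f α y) / γ) ∂β := by
  rw [integral_prod_symm _ (integrable_of_continuous (continuous_gibbs hc hf hg))]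
  exact integral_congr_ae (ae_of_all _ fun y => integral_gibbs_left α hγ hc hf g y)

lemma integral_prod_gibbs_right (hγ : 0 < γ) (hc : Continuous (fun z : X × X => c z.1 z.2))
    (hs : ∀ x y, c x y = c y x) {f g : X → ℝ} (hf : Continuous f) (hg : Continuous g) :
    ∫ z, gibbs γ c f g z ∂(α.prod β) =
      ∫ x, Real.exp ((f x - sinkhornMap γ c g β x) / γ) ∂α := by
  rw [integral_prod _ (integrable_of_continuous (continuous_gibbs hc hf hg))]
  exact integral_congr_ae (ae_of_all _ fun x => integral_gibbs_right β hγ hc hs f hg x)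

variable {α} in
/-- Jensen's inequality for the exponential, with its equality case. -/
lemma integral_nonpos_of_integral_exp_eq_one {u : X → ℝ} (hu : Continuous u)
    (h : ∫ x, Real.exp (u x) ∂α = 1) :
    ∫ x, u x ∂α ≤ 0 ∧ (0 ≤ ∫ x, u x ∂α → ∀ᵐ x ∂α, u x = 0) := by
  have hi : Integrable u α := integrable_of_continuous hu
  have he : Integrable (fun x => Real.exp (u x)) α := integrable_of_continuous (by fun_prop)
  have h0 : 0 ≤ fun x => Real.exp (u x) - 1 - u x := fun x => by
    have := Real.add_one_le_exp (u x)
    simp only [Pi.zero_apply]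
    linarith
  have h1 : ∫ x, (Real.exp (u x) - 1 - u x) ∂α = - ∫ x, u x ∂α := by
    have h1 : Integrable (fun x => Real.exp (u x) - 1) α := he.sub (integrable_const _)
    rw [integral_sub h1 hi, integral_sub he (integrable_const _), h]
    simp
  have h2 := integral_nonneg (μ := α) h0
  rw [h1] at h2
  refine ⟨by linarith, fun h3 => ?_⟩
  have h4 : ∫ x, (Real.exp (u x) - 1 - u x) ∂α = 0 := by rw [h1]; linarith
  have h5 := (integral_eq_zero_iff_of_nonneg h0 ((he.sub (integrable_const _)).sub hi)).1 h4
  filter_upwards [h5] with x hx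
  by_contra hne
  have := Real.add_one_lt_exp hne
  simp only [Pi.zero_apply] at hx
  linarith

/-- The Sinkhorn mapping as a map of `C(X)`. -/
noncomputable def sinkhornC {Mc Gc Lc : ℝ} (hγ : 0 < γ) (hc : CostAssumption c Mc Gc Lc)
    (f : C(X, ℝ)) : C(X, ℝ) where
  toFun := sinkhornMap γ c f α
  continuous_toFun := by
    refine (LipschitzWith.of_dist_le_mul (K := |Gc|.toNNReal) fun y y' => ?_).continuous
    rw [Real.coe_toNNReal _ (abs_nonneg _), Real.dist_eq]
    exact sinkhornMap_sub_le hγ hc f.continuous y y'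

lemma sinkhornC_sub_le {Mc Gc Lc : ℝ} (hγ : 0 < γ) (hc : CostAssumption c Mc Gc Lc)
    (f f' : C(X, ℝ)) : dist (sinkhornC α hγ hc f) (sinkhornC α hγ hc f') ≤ dist f f' := by
  rw [ContinuousMap.dist_le dist_nonneg]
  intro y
  have key : ∀ f f' : C(X, ℝ),
      sinkhornMap γ c f' α y ≤ sinkhornMap γ c f α y + dist f f' := fun f f' => by
    refine sinkhornMap_le hγ hc.continuous f.continuous f'.continuous fun x => ?_
    have := (abs_le.1 (ContinuousMap.dist_apply_le_dist (f := f) (g := f') x)).2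
    linarith
  have h1 := key f f'
  have h2 := key f' f
  rw [dist_comm] at h2
  rw [Real.dist_eq, abs_le]
  change _ ≤ sinkhornMap γ c f α y - sinkhornMap γ c f' α y ∧
    sinkhornMap γ c f α y - sinkhornMap γ c f' α y ≤ _
  constructor <;> linarith

lemma sinkhornMap_sub_const (hγ : 0 < γ) (hc : Continuous (fun z : X × X => c z.1 z.2))
    {f : X → ℝ} (hf : Continuous f) (t : ℝ) (y : X) :
    sinkhornMap γ c (fun x => f x - t) α y = sinkhornMap γ c f α y + t := by
  have hf' : Continuous (fun x => f x - t) := by fun_prop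
  refine le_antisymm (sinkhornMap_le hγ hc hf hf' fun x => by linarith) ?_
  have := sinkhornMap_le (α := α) hγ hc hf' hf (y := y) (y' := y) (L := -t)
    fun x => by linarith
  linarith

lemma continuous_integral_continuousMap : Continuous (fun f : C(X, ℝ) => ∫ x, f x ∂α) := by
  refine (LipschitzWith.of_dist_le_mul (K := 1) fun f f' => ?_).continuous
  rw [dist_eq_norm, ← integral_sub (integrable_of_continuous f.continuous)
    (integrable_of_continuous f'.continuous)]
  refine (norm_integral_le_of_norm_le_const (C := dist f f') (ae_of_all _ fun x => ?_)).trans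
    (by simp)
  exact ContinuousMap.dist_apply_le_dist (f := f) (g := f') x

/-- The Schrödinger system has a continuous solution. -/
lemma exists_sinkhorn_fixedPoint {Mc Gc Lc : ℝ} (hγ : 0 < γ) (hc : CostAssumption c Mc Gc Lc) :
    ∃ f g : C(X, ℝ), (∀ x, f x = sinkhornMap γ c g β x) ∧
      ∀ y, g y = sinkhornMap γ c f α y := by
  obtain ⟨x₀⟩ : Nonempty X := nonempty_of_isProbabilityMeasure α
  have hcc := hc.continuous
  -- The semi-dual functional: `f` is paired with its best response.
  let Φ : C(X, ℝ) → ℝ := fun f => ∫ x, f x ∂α + ∫ y, sinkhornC α hγ hc f y ∂β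
  have hA : Continuous (sinkhornC α hγ hc) :=
    (LipschitzWith.of_dist_le_mul (K := 1) fun f f' => by
      simpa using sinkhornC_sub_le α hγ hc f f').continuous
  have hΦ : Continuous Φ := (continuous_integral_continuousMap α).add
    ((continuous_integral_continuousMap β).comp hA)
  obtain ⟨f, -, hmax⟩ := (isCompact_lipschitz_normalized (X := X) |Gc|.toNNReal x₀).exists_isMaxOn
    ⟨0, LipschitzWith.const' (0 : ℝ), rfl⟩ hΦ.continuousOn
  set g := sinkhornC α hγ hc f with hg
  set f' := sinkhornC β hγ hc g with hf'
  set g' := sinkhornC α hγ hc f' with hg'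
  have hf'lip : LipschitzWith |Gc|.toNNReal f' := by
    refine LipschitzWith.of_dist_le_mul fun y y' => ?_
    rw [Real.coe_toNNReal _ (abs_nonneg _), Real.dist_eq]
    exact sinkhornMap_sub_le hγ hc g.continuous y y'
  -- `Φ` ignores constants added to its argument, so the maximiser among normalised functions also
  -- beats `f'`, which is Lipschitz as a Sinkhorn image but need not vanish at `x₀`.
  have hshift : Φ f' ≤ Φ f := by
    have h1 : f' - ContinuousMap.const X (f' x₀) ∈
        {f : C(X, ℝ) | LipschitzWith |Gc|.toNNReal f ∧ f x₀ = 0} := by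
      refine ⟨LipschitzWith.of_dist_le_mul fun y y' => ?_, by simp⟩
      simpa using hf'lip.dist_le_mul y y'
    have h2 : Φ (f' - ContinuousMap.const X (f' x₀)) = Φ f' := by
      have h3 : ∀ y, sinkhornC α hγ hc (f' - ContinuousMap.const X (f' x₀)) y
          = sinkhornC α hγ hc f' y + f' x₀ := fun y =>
        sinkhornMap_sub_const α hγ hcc f'.continuous (f' x₀) y
      simp only [Φ, h3]
      rw [integral_add (integrable_of_continuous (ContinuousMap.continuous _))
        (integrable_const _)]
      simp only [ContinuousMap.coe_sub, Pi.sub_apply, ContinuousMap.const_apply]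
      rw [integral_sub (integrable_of_continuous (ContinuousMap.continuous _))
        (integrable_const _)]
      simp
    rw [← h2]
    exact hmax h1
  -- The total mass of `gibbs γ c f g`, integrated in the two orders: one gives 1 because `g` is the
  -- Sinkhorn image of `f`.
  have e1 : ∫ x, Real.exp ((f x - f' x) / γ) ∂α = 1 := by
    have h := integral_prod_gibbs_right α β hγ hcc hc.symm f.continuous g.continuous
    rw [integral_prod_gibbs_left α β hγ hcc f.continuous g.continuous] at h
    refine h.symm.trans ?_
    have : ∀ y, g y - sinkhornMap γ c f α y = 0 := fun y => sub_self _
    simp [this]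
  have e2 : ∫ y, Real.exp ((g y - g' y) / γ) ∂β = 1 := by
    have h := integral_prod_gibbs_left α β hγ hcc f'.continuous g.continuous
    rw [integral_prod_gibbs_right α β hγ hcc hc.symm f'.continuous g.continuous] at h
    refine h.symm.trans ?_
    have : ∀ x, f' x - sinkhornMap γ c g β x = 0 := fun y => sub_self _
    simp [this]
  have j1 := (integral_nonpos_of_integral_exp_eq_one (by fun_prop) e1).1
  have j2 := (integral_nonpos_of_integral_exp_eq_one (by fun_prop) e2).2
  have hint : ∀ (h : C(X, ℝ)) (μ : Measure X) [IsProbabilityMeasure μ], Integrable h μ :=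
    fun h μ _ => integrable_of_continuous h.continuous
  rw [integral_div, integral_sub (hint _ _) (hint _ _)] at j1 j2
  have j3 : ∫ x, f x ∂α ≤ ∫ x, f' x ∂α := by
    have := (div_nonpos_iff.1 j1).resolve_left (fun h => absurd h.2 (not_le.2 hγ))
    linarith [this.1]
  -- Jensen gives `∫ f ≤ ∫ f'`, so maximality forces `∫ g' ≤ ∫ g`, which is the equality case of the
  -- second Jensen inequality.
  have j4 : ∀ᵐ y ∂β, (g y - g' y) / γ = 0 := by
    refine j2 (div_nonneg ?_ hγ.le)
    have : (∫ x, f' x ∂α) + ∫ y, g' y ∂β ≤ (∫ x, f x ∂α) + ∫ y, g y ∂β := hshift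
    linarith
  -- `g` and `g'` agree only `β`-a.e., but the Sinkhorn mapping with respect to `β` sees no more
  -- than that, so the first equation holds at every point.
  refine ⟨f', g', fun x => ?_, fun y => rfl⟩
  change sinkhornMap γ c g β x = sinkhornMap γ c g' β x
  simp only [sinkhornMap]
  congr 2
  refine integral_congr_ae ?_
  filter_upwards [j4] with y hy
  have : g y = g' y := by
    have := (div_eq_zero_iff.1 hy).resolve_right hγ.ne'
    linarith
  rw [this]

end SinkhornMap

/-! ### Entropic duality and the optimal plan. -/

section Duality

open InformationTheory

variable {c : X → X → ℝ} {γ : ℝ} {μ ν : Measure X}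

instance [IsProbabilityMeasure μ] : IsProbabilityMeasure (incl μ) :=
  Measure.isProbabilityMeasure_map measurable_subtype_coe.aemeasurable

lemma isFiniteMeasure_of_fst {Y Z : Type*} [MeasurableSpace Y] [MeasurableSpace Z]
    {π : Measure (Y × Z)} {μ : Measure Y} [IsFiniteMeasure μ] (h : π.fst = μ) :
    IsFiniteMeasure π :=
  ⟨by rw [← Measure.fst_univ, h]; exact measure_lt_top μ _⟩

lemma fst_map_prodMap {Y Z Y' Z' : Type*} [MeasurableSpace Y] [MeasurableSpace Z]
    [MeasurableSpace Y'] [MeasurableSpace Z'] (π : Measure (Y × Z)) {S : Y → Y'} {T : Z → Z'}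
    (hS : Measurable S) (hT : Measurable T) : (π.map (Prod.map S T)).fst = π.fst.map S := by
  rw [Measure.fst, Measure.fst, Measure.map_map measurable_fst (hS.prodMap hT),
    Measure.map_map hS measurable_fst]
  rfl

lemma snd_map_prodMap {Y Z Y' Z' : Type*} [MeasurableSpace Y] [MeasurableSpace Z]
    [MeasurableSpace Y'] [MeasurableSpace Z'] (π : Measure (Y × Z)) {S : Y → Y'} {T : Z → Z'}
    (hS : Measurable S) (hT : Measurable T) : (π.map (Prod.map S T)).snd = π.snd.map T := by
  rw [Measure.snd, Measure.snd, Measure.map_map measurable_snd (hS.prodMap hT),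
    Measure.map_map hT measurable_snd]
  rfl

/-- A measurable retraction onto `X` carries couplings on the ambient space to couplings on `X`. It
does not raise the cost, which is infinite off `X`, nor the divergence, by data processing. -/
lemma le_OT_incl [CompactSpace X] [IsProbabilityMeasure μ] [IsProbabilityMeasure ν] {B : ℝ≥0∞}
    (hc : Continuous (fun z : X × X => c z.1 z.2))
    (h : ∀ π : Measure (X × X), π.fst = μ → π.snd = ν →
      B ≤ (∫⁻ z, ENNReal.ofReal (c z.1 z.2) ∂π) + ENNReal.ofReal γ * klDiv π (μ.prod ν)) :
    B ≤ OT γ c (incl μ) (incl ν) := by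
  obtain ⟨x₀⟩ : Nonempty X := nonempty_of_isProbabilityMeasure μ
  have hXm : MeasurableSet X := (isCompact_iff_compactSpace.2 inferInstance).measurableSet
  obtain ⟨R, hR, hRX⟩ := (MeasurableEmbedding.subtype_coe hXm).exists_measurable_extend
    measurable_id (fun _ => ⟨x₀⟩)
  have hincl : ∀ μ : Measure X, (incl μ).map R = μ := fun μ => by
    rw [incl, Measure.map_map hR measurable_subtype_coe, hRX, Measure.map_id]
  refine le_iInf₂ fun π hπ => ?_
  have : IsFiniteMeasure π := isFiniteMeasure_of_fst hπ.1
  have hRR : Measurable (Prod.map R R) := hR.prodMap hR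
  refine (h (π.map (Prod.map R R)) ?_ ?_).trans (add_le_add ?_ (mul_le_mul_right ?_ _))
  · rw [fst_map_prodMap _ hR hR, hπ.1, hincl]
  · rw [snd_map_prodMap _ hR hR, hπ.2, hincl]
  · rw [lintegral_map hc.measurable.ennreal_ofReal hRR]
    refine lintegral_mono fun z => ?_
    rw [extCost]
    split_ifs with hz
    · have h1 : R z.1 = ⟨z.1, hz.1⟩ := congrFun hRX ⟨z.1, hz.1⟩
      have h2 : R z.2 = ⟨z.2, hz.2⟩ := congrFun hRX ⟨z.2, hz.2⟩
      simp [h1, h2]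
    · exact le_top
  · have h1 := klDiv_map_le π ((incl μ).prod (incl ν)) hRR
    rwa [← Measure.map_prod_map _ _ hR hR, hincl, hincl] at h1

lemma OT_incl_le [IsProbabilityMeasure μ] [IsProbabilityMeasure ν]
    (hX : MeasurableSet X)
    {π : Measure (X × X)} (h1 : π.fst = μ) (h2 : π.snd = ν) :
    OT γ c (incl μ) (incl ν) ≤
      (∫⁻ z, ENNReal.ofReal (c z.1 z.2) ∂π) + ENNReal.ofReal γ * klDiv π (μ.prod ν) := by
  have : IsFiniteMeasure π := isFiniteMeasure_of_fst h1
  have hm : Measurable ((↑) : X → E d) := measurable_subtype_coe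
  have hmem : π.map (Prod.map (↑) (↑)) ∈ couplings (incl μ) (incl ν) :=
    ⟨by rw [fst_map_prodMap _ hm hm, h1, incl], by rw [snd_map_prodMap _ hm hm, h2, incl]⟩
  refine (iInf₂_le _ hmem).trans (add_le_add ?_ (mul_le_mul_right ?_ _))
  · rw [((MeasurableEmbedding.subtype_coe hX).prodMap
      (MeasurableEmbedding.subtype_coe hX)).lintegral_map]
    refine lintegral_mono fun z => ?_
    simp [extCost]
  · have h3 := klDiv_map_le π (μ.prod ν) (hm.prodMap hm)
    rwa [← Measure.map_prod_map _ _ hm hm] at h3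

/-- The Fenchel–Young inequality for the entropy. -/
lemma mul_le_klFun_add_exp {r : ℝ} (hr : 0 ≤ r) (a : ℝ) :
    a * r ≤ klFun r + (Real.exp a - 1) := by
  rw [klFun_apply]
  rcases hr.eq_or_lt with rfl | hr
  · simpa using (Real.exp_pos a).le
  · have h1 := mul_le_mul_of_nonneg_left (Real.add_one_le_exp (a - Real.log r)) hr.le
    rw [Real.exp_sub, Real.exp_log hr, mul_div_cancel₀ _ hr.ne'] at h1
    linarith

/-- The optimal plan, with density `gibbs` with respect to `α ⊗ β`. -/
noncomputable def gibbsPlan (γ : ℝ) (c : X → X → ℝ) (α β : Measure X) (f g : X → ℝ) :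
    Measure (X × X) :=
  (α.prod β).withDensity fun z => ENNReal.ofReal (gibbs γ c f g z)

lemma integral_gibbsPlan {α β : Measure X} {f g : C(X, ℝ)}
    (hc : Continuous (fun z : X × X => c z.1 z.2)) (h : X × X → ℝ) :
    ∫ z, h z ∂(gibbsPlan γ c α β f g) = ∫ z, gibbs γ c f g z * h z ∂(α.prod β) := by
  rw [gibbsPlan, integral_withDensity_eq_integral_toReal_smul
    (continuous_gibbs hc f.continuous g.continuous).measurable.ennreal_ofReal (by simp)]
  simp [ENNReal.toReal_ofReal (gibbs_pos _).le]

variable [CompactSpace X]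

/-- Weak duality. -/
lemma ofReal_dualObjective_le_OT [IsProbabilityMeasure μ] [IsProbabilityMeasure ν] (hγ : 0 < γ)
    (hc : Continuous (fun z : X × X => c z.1 z.2)) (hc0 : ∀ x y, 0 ≤ c x y)
    (p : C(X, ℝ) × C(X, ℝ)) :
    ENNReal.ofReal (dualObjective γ c μ ν p) ≤ OT γ c (incl μ) (incl ν) := by
  refine le_OT_incl hc fun π h1 h2 => ?_
  have : IsFiniteMeasure π := isFiniteMeasure_of_fst h1
  by_cases hkl : klDiv π (μ.prod ν) = ∞
  · rw [hkl, ENNReal.mul_top (by simpa using hγ), add_top]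
    exact le_top
  obtain ⟨hac, hint⟩ := klDiv_ne_top_iff.1 hkl
  have hkint := (integrable_klFun_rnDeriv_iff hac).2 hint
  rw [klDiv_eq_integral_klFun, if_pos ⟨hac, hint⟩, ← ENNReal.ofReal_mul hγ.le,
    ← ofReal_integral_eq_lintegral_ofReal (integrable_of_continuous hc)
      (ae_of_all _ fun z => hc0 _ _), ← ENNReal.ofReal_add (integral_nonneg fun z => hc0 _ _)
      (mul_nonneg hγ.le (integral_nonneg fun z => klFun_nonneg ENNReal.toReal_nonneg))]
  refine ENNReal.ofReal_le_ofReal ?_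
  set a : X × X → ℝ := fun z => (p.1 z.1 + p.2 z.2 - c z.1 z.2) / γ with ha
  have hac' : Continuous a := by fun_prop
  have hexp : Integrable (fun z => Real.exp (a z) - 1) (μ.prod ν) :=
    integrable_of_continuous (by fun_prop)
  -- Fenchel–Young at the density of `π` with slope `a`, integrated against the product measure.
  have key : ∫ z, a z ∂π ≤ ∫ z, klFun (π.rnDeriv (μ.prod ν) z).toReal ∂(μ.prod ν)
      + ∫ z, (Real.exp (a z) - 1) ∂(μ.prod ν) := by
    have : π.HaveLebesgueDecomposition (μ.prod ν) :=
      Measure.haveLebesgueDecomposition_of_sigmaFinite _ _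
    rw [← integral_rnDeriv_smul hac, ← integral_add hkint hexp]
    refine integral_mono ((integrable_rnDeriv_smul_iff hac).2 (integrable_of_continuous hac'))
      (hkint.add hexp) fun z => ?_
    simp only [smul_eq_mul]
    rw [mul_comm]
    exact mul_le_klFun_add_exp ENNReal.toReal_nonneg _
  have i1 : Integrable (fun z : X × X => p.1 z.1) π := integrable_of_continuous (by fun_prop)
  have i2 : Integrable (fun z : X × X => p.2 z.2) π := integrable_of_continuous (by fun_prop)
  have hsplit : ∫ z, a z ∂π = ((∫ x, p.1 x ∂μ) + (∫ y, p.2 y ∂ν) - ∫ z, c z.1 z.2 ∂π) / γ := by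
    have i3 : Integrable (fun z : X × X => p.1 z.1 + p.2 z.2) π := i1.add i2
    rw [ha, integral_div, integral_sub i3 (integrable_of_continuous hc),
      integral_add i1 i2, ← h1, ← h2, Measure.fst, Measure.snd,
      integral_map measurable_fst.aemeasurable p.1.continuous.aestronglyMeasurable,
      integral_map measurable_snd.aemeasurable p.2.continuous.aestronglyMeasurable]
  rw [hsplit, div_le_iff₀ hγ] at key
  simp only [dualObjective]
  linarith

variable {α β : Measure X} [IsProbabilityMeasure α] [IsProbabilityMeasure β] {f g : C(X, ℝ)}

lemma integral_gibbs_left_eq_one (hγ : 0 < γ) (hc : Continuous (fun z : X × X => c z.1 z.2))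
    (hg : ∀ y, g y = sinkhornMap γ c f α y) (y : X) : ∫ x, gibbs γ c f g (x, y) ∂α = 1 := by
  rw [integral_gibbs_left α hγ hc f.continuous, ← hg y]
  simp

lemma integral_gibbs_right_eq_one (hγ : 0 < γ) (hc : Continuous (fun z : X × X => c z.1 z.2))
    (hs : ∀ x y, c x y = c y x) (hf : ∀ x, f x = sinkhornMap γ c g β x) (x : X) :
    ∫ y, gibbs γ c f g (x, y) ∂β = 1 := by
  rw [integral_gibbs_right β hγ hc hs f g.continuous, ← hf x]
  simp

/-- The Schrödinger equation for `f` is exactly the first marginal constraint on the plan; the one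
for `g` is the second. -/
lemma fst_gibbsPlan (hγ : 0 < γ) (hc : Continuous (fun z : X × X => c z.1 z.2))
    (hs : ∀ x y, c x y = c y x) (hf : ∀ x, f x = sinkhornMap γ c g β x) :
    (gibbsPlan γ c α β f g).fst = α := by
  have hm := (continuous_gibbs (γ := γ) hc f.continuous g.continuous)
  ext s hs'
  rw [Measure.fst_apply hs', gibbsPlan, withDensity_apply _ (measurable_fst hs'),
    ← Set.prod_univ, ← Measure.prod_restrict, Measure.restrict_univ,
    lintegral_prod _ hm.measurable.ennreal_ofReal.aemeasurable]
  have : ∀ x, ∫⁻ y, ENNReal.ofReal (gibbs γ c f g (x, y)) ∂β = 1 := fun x => by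
    rw [← ofReal_integral_eq_lintegral_ofReal (integrable_of_continuous (by fun_prop))
      (ae_of_all _ fun y => (gibbs_pos _).le), integral_gibbs_right_eq_one hγ hc hs hf]
    simp
  simp [this]

lemma snd_gibbsPlan (hγ : 0 < γ) (hc : Continuous (fun z : X × X => c z.1 z.2))
    (hg : ∀ y, g y = sinkhornMap γ c f α y) :
    (gibbsPlan γ c α β f g).snd = β := by
  have hm := (continuous_gibbs (γ := γ) hc f.continuous g.continuous)
  ext s hs'
  rw [Measure.snd_apply hs', gibbsPlan, withDensity_apply _ (measurable_snd hs'),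
    ← Set.univ_prod, ← Measure.prod_restrict, Measure.restrict_univ,
    lintegral_prod_symm _ hm.measurable.ennreal_ofReal.aemeasurable]
  have : ∀ y, ∫⁻ x, ENNReal.ofReal (gibbs γ c f g (x, y)) ∂α = 1 := fun y => by
    rw [← ofReal_integral_eq_lintegral_ofReal (integrable_of_continuous (by fun_prop))
      (ae_of_all _ fun y => (gibbs_pos _).le), integral_gibbs_left_eq_one hγ hc hg]
    simp
  simp [this]

lemma klDiv_gibbsPlan (hc : Continuous (fun z : X × X => c z.1 z.2)) :
    klDiv (gibbsPlan γ c α β f g) (α.prod β) =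
      ENNReal.ofReal (∫ z, klFun (gibbs γ c f g z) ∂(α.prod β)) := by
  have hm := (continuous_gibbs (γ := γ) hc f.continuous g.continuous)
  have hi : Integrable (gibbs γ c f g) (α.prod β) := integrable_of_continuous hm
  have hi' : Integrable (fun z => klFun (gibbs γ c f g z)) (α.prod β) :=
    integrable_of_continuous (continuous_klFun.comp hm)
  have := isFiniteMeasure_withDensity_ofReal hi.hasFiniteIntegral
  rw [gibbsPlan, klDiv_eq_lintegral_klFun_of_ac (withDensity_absolutelyContinuous _ _),
    ofReal_integral_eq_lintegral_ofReal hi'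
      (ae_of_all _ fun z => klFun_nonneg (gibbs_pos _).le)]
  refine lintegral_congr_ae ?_
  filter_upwards [Measure.rnDeriv_withDensity (α.prod β) hm.measurable.ennreal_ofReal] with z hz
  rw [hz, ENNReal.toReal_ofReal (gibbs_pos _).le]

/-- The primal value of the push-forward of the optimal plan bounds the transport cost of the
push-forwards. -/
lemma OT_incl_map_le (hγ : 0 < γ) (hc : Continuous (fun z : X × X => c z.1 z.2))
    (hs : ∀ x y, c x y = c y x) (hc0 : ∀ x y, 0 ≤ c x y)
    (hf : ∀ x, f x = sinkhornMap γ c g β x) (hg : ∀ y, g y = sinkhornMap γ c f α y)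
    {S T : X → X} (hS : Measurable S) (hT : Measurable T) :
    OT γ c (incl (α.map S)) (incl (β.map T)) ≤ ENNReal.ofReal
      (∫ z, gibbs γ c f g z * c (S z.1) (T z.2) ∂(α.prod β) +
        γ * ∫ z, klFun (gibbs γ c f g z) ∂(α.prod β)) := by
  have hXm : MeasurableSet X := (isCompact_iff_compactSpace.2 inferInstance).measurableSet
  have : IsProbabilityMeasure (α.map S) := Measure.isProbabilityMeasure_map hS.aemeasurable
  have : IsProbabilityMeasure (β.map T) := Measure.isProbabilityMeasure_map hT.aemeasurable
  have hfst := fst_gibbsPlan (α := α) hγ hc hs hf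
  have hsnd := snd_gibbsPlan (β := β) hγ hc hg
  have : IsFiniteMeasure (gibbsPlan γ c α β f g) := isFiniteMeasure_of_fst hfst
  refine (OT_incl_le hXm (π := (gibbsPlan γ c α β f g).map (Prod.map S T)) ?_ ?_).trans ?_
  · rw [fst_map_prodMap _ hS hT, hfst]
  · rw [snd_map_prodMap _ hS hT, hsnd]
  obtain ⟨C, hC⟩ := isCompact_univ.exists_bound_of_continuousOn hc.continuousOn
  have hcm : Measurable (fun z : X × X => c (S z.1) (T z.2)) :=
    hc.measurable.comp (hS.prodMap hT)
  rw [ENNReal.ofReal_add, ENNReal.ofReal_mul hγ.le, ← klDiv_gibbsPlan hc,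
    ← integral_gibbsPlan hc, ofReal_integral_eq_lintegral_ofReal
      (Integrable.of_bound hcm.aestronglyMeasurable C
        (ae_of_all _ fun z => hC (S z.1, T z.2) trivial)) (ae_of_all _ fun z => hc0 _ _),
    lintegral_map hc.measurable.ennreal_ofReal (hS.prodMap hT), Measure.map_prod_map _ _ hS hT]
  · gcongr
    · rfl
    · exact klDiv_map_le _ _ (hS.prodMap hT)
  · exact integral_nonneg fun z => mul_nonneg (gibbs_pos _).le (hc0 _ _)
  · exact mul_nonneg hγ.le (integral_nonneg fun z => klFun_nonneg (gibbs_pos _).le)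

lemma integral_gibbs_eq_one (hγ : 0 < γ) (hc : Continuous (fun z : X × X => c z.1 z.2))
    (hg : ∀ y, g y = sinkhornMap γ c f α y) : ∫ z, gibbs γ c f g z ∂(α.prod β) = 1 := by
  rw [integral_prod_gibbs_left α β hγ hc f.continuous g.continuous]
  simp [← hg]

/-- The primal value of the optimal plan is the dual value of the potentials. -/
lemma primal_gibbs_eq (hγ : 0 < γ) (hc : Continuous (fun z : X × X => c z.1 z.2))
    (hs : ∀ x y, c x y = c y x)
    (hf : ∀ x, f x = sinkhornMap γ c g β x) (hg : ∀ y, g y = sinkhornMap γ c f α y) :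
    ∫ z, gibbs γ c f g z * c z.1 z.2 ∂(α.prod β) +
        γ * ∫ z, klFun (gibbs γ c f g z) ∂(α.prod β) = (∫ x, f x ∂α) + ∫ y, g y ∂β := by
  have hm := (continuous_gibbs (γ := γ) hc f.continuous g.continuous)
  have i0 : ∀ h : X × X → ℝ, Continuous h → Integrable h (α.prod β) := fun h hh =>
    integrable_of_continuous hh
  have hfst := fst_gibbsPlan (α := α) hγ hc hs hf
  have hsnd := snd_gibbsPlan (β := β) hγ hc hg
  have e1 : ∫ x, f x ∂α = ∫ z, gibbs γ c f g z * f z.1 ∂(α.prod β) := by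
    rw [← integral_gibbsPlan hc]
    conv_lhs => rw [← hfst, Measure.fst,
      integral_map measurable_fst.aemeasurable f.continuous.aestronglyMeasurable]
  have e2 : ∫ x, g x ∂β = ∫ z, gibbs γ c f g z * g z.2 ∂(α.prod β) := by
    rw [← integral_gibbsPlan hc]
    conv_lhs => rw [← hsnd, Measure.snd,
      integral_map measurable_snd.aemeasurable g.continuous.aestronglyMeasurable]
  -- `log gibbs` is the exponent itself, and the remaining term `1 - gibbs` integrates to zero
  -- because the plan has mass 1.
  have e3 : ∫ z, klFun (gibbs γ c f g z) ∂(α.prod β) =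
      ∫ z, gibbs γ c f g z * ((f z.1 + g z.2 - c z.1 z.2) / γ) ∂(α.prod β) := by
    have : ∀ z, klFun (gibbs γ c f g z) =
        gibbs γ c f g z * ((f z.1 + g z.2 - c z.1 z.2) / γ) + (1 - gibbs γ c f g z) := by
      intro z
      rw [klFun_apply, gibbs, Real.log_exp]
      ring
    simp_rw [this]
    rw [integral_add (i0 _ (by fun_prop)) (i0 _ (by fun_prop)),
      integral_sub (i0 _ (by fun_prop)) (i0 _ hm), integral_gibbs_eq_one hγ hc hg]
    simp
  rw [e1, e2, e3, ← integral_const_mul, ← integral_add (i0 _ (by fun_prop)) (i0 _ (by fun_prop)),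
    ← integral_add (i0 _ (by fun_prop)) (i0 _ (by fun_prop))]
  refine integral_congr_ae (ae_of_all _ fun z => ?_)
  simp only
  field_simp
  ring

lemma dualObjective_eq (hγ : 0 < γ) (hc : Continuous (fun z : X × X => c z.1 z.2))
    (hg : ∀ y, g y = sinkhornMap γ c f α y) :
    dualObjective γ c α β (f, g) = (∫ x, f x ∂α) + ∫ y, g y ∂β := by
  have := integral_gibbs_eq_one (β := β) hγ hc hg
  simp only [gibbs] at this
  rw [dualObjective, integral_sub (integrable_of_continuous (by fun_prop)) (integrable_const _),
    this]
  simp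

/-- Every dual value is at most the transport cost, hence at most the primal value of the Gibbs
plan, which equals the dual value at `(f, g)`. -/
lemma isSinkhornPotentials_of_fixedPoint (hγ : 0 < γ)
    (hc : Continuous (fun z : X × X => c z.1 z.2))
    (hs : ∀ x y, c x y = c y x) (hc0 : ∀ x y, 0 ≤ c x y)
    (hf : ∀ x, f x = sinkhornMap γ c g β x) (hg : ∀ y, g y = sinkhornMap γ c f α y) :
    IsSinkhornPotentials γ c α β f g := by
  refine ⟨fun p => ?_, hf, hg⟩
  have h1 := ofReal_dualObjective_le_OT (μ := α) (ν := β) hγ hc hc0 p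
  have h2 := OT_incl_map_le (α := α) (β := β) hγ hc hs hc0 hf hg measurable_id measurable_id
  simp only [Measure.map_id, id] at h2
  have h3 := h1.trans h2
  rw [dualObjective_eq hγ hc hg, ← primal_gibbs_eq hγ hc hs hf hg]
  rwa [ENNReal.ofReal_le_ofReal_iff] at h3
  exact add_nonneg (integral_nonneg fun z => mul_nonneg (gibbs_pos _).le (hc0 _ _))
    (mul_nonneg hγ.le (integral_nonneg fun z => klFun_nonneg (gibbs_pos _).le))

end Duality

/-! ### Gradients of the cost and of the potentials. -/

section Gradient

variable {c : X → X → ℝ} {Mc Gc Lc γ : ℝ}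

lemma extZero_apply (f : X → ℝ) (x : X) : extZero f x = f x :=
  Subtype.val_injective.extend_apply _ _ _

lemma extZero_of_mem (f : X → ℝ) {x : E d} (hx : x ∈ X) : extZero f x = f ⟨x, hx⟩ :=
  extZero_apply f ⟨x, hx⟩

/-- The partial gradient `∇₁ c (x, y)`. -/
noncomputable def costGrad (c : X → X → ℝ) (x y : X) : E d := grad (fun z => c z y) x

lemma hasGradientWithinAt_cost (hc : CostAssumption c Mc Gc Lc) (x y : X) :
    HasGradientWithinAt (extZero fun z => c z y) (costGrad c x y) X x :=
  DifferentiableWithinAt.hasGradientWithinAt (hc.diff x y)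

lemma grad_eq_of_hasGradientWithinAt (hXd : UniqueDiffOn ℝ X) {f : X → ℝ} {x : X} {p : E d}
    (h : HasGradientWithinAt (extZero f) p X x) : grad f x = p := by
  rw [grad, gradientWithin, h.hasFDerivWithinAt.fderivWithin (hXd x x.2),
    LinearIsometryEquiv.symm_apply_apply]

/-- Nothing is assumed on `∇₁ c (x, y)` as a function of `y`. Along a tangent direction it is a
limit of difference quotients, which are measurable in `y` and eventually bounded by the Lipschitz
estimate. -/
lemma inner_costGrad_of_tangent (hc : CostAssumption c Mc Gc Lc) {x : X} {v : E d}
    (hv : v ∈ tangentConeAt ℝ X x) :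
    Measurable (fun y => inner ℝ (costGrad c x y) v) ∧
      ∀ y, |inner ℝ (costGrad c x y) v| ≤ |Gc| * ‖v‖ := by
  obtain ⟨a, e, he, heX, hae⟩ := mem_tangentConeAt_iff_exists_seq.1 hv
  have hlim : ∀ y, Tendsto
      (fun n => a n • (extZero (fun z => c z y) (x + e n) - extZero (fun z => c z y) x)) atTop
      (𝓝 (inner ℝ (costGrad c x y) v)) := fun y =>
    (hasGradientWithinAt_cost hc x y).hasFDerivWithinAt.lim he heX hae
  constructor
  · refine measurable_of_tendsto_metrizable (fun n => ?_) (tendsto_pi_nhds.2 hlim)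
    refine (Measurable.sub (f := fun y => extZero (fun z => c z y) (x + e n))
      (g := fun y => extZero (fun z => c z y) x) ?_ ?_).const_smul (a n)
    · by_cases hn : (x : E d) + e n ∈ X
      · simp only [extZero_of_mem _ hn]
        exact (hc.continuous.comp (Continuous.prodMk_right _)).measurable
      · have : ∀ y, extZero (fun z => c z y) (x + e n) = 0 := fun y =>
          Function.extend_apply' _ _ _ (by rintro ⟨z, hz⟩; exact hn (hz ▸ z.2))
        simp only [this]
        exact measurable_const
    · simp only [extZero_apply]
      exact (hc.continuous.comp (Continuous.prodMk_right _)).measurable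
  · intro y
    refine le_of_tendsto_of_tendsto ((continuous_abs.tendsto _).comp (hlim y))
      ((hae.norm).const_mul |Gc|) ?_
    filter_upwards [heX] with n hn
    simp only [Function.comp_apply, extZero_of_mem _ hn, extZero_apply, smul_eq_mul, abs_mul,
      norm_smul, Real.norm_eq_abs]
    have := hc.abs_sub_le ⟨x + e n, hn⟩ x y
    rw [Subtype.dist_eq, dist_eq_norm, add_sub_cancel_left] at this
    calc _ ≤ |a n| * (|Gc| * ‖e n‖) := by gcongr
      _ = _ := by ring

/-- At a fixed point `x`, the inner products with `∇₁ c (x, ·)` are measurable and bounded. -/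
lemma inner_costGrad (hXd : UniqueDiffOn ℝ X) (hc : CostAssumption c Mc Gc Lc) (x : X)
    (v : E d) : Measurable (fun y => inner ℝ (costGrad c x y) v) ∧
      ∃ C, ∀ y, |inner ℝ (costGrad c x y) v| ≤ C := by
  -- The good directions form a subspace containing the tangent cone, whose span is dense; in finite
  -- dimension a dense subspace is everything.
  let W : Submodule ℝ (E d) :=
    { carrier := {v | Measurable (fun y => inner ℝ (costGrad c x y) v) ∧
        ∃ C, ∀ y, |inner ℝ (costGrad c x y) v| ≤ C}
      add_mem' := by
        rintro v w ⟨hv, C, hC⟩ ⟨hw, C', hC'⟩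
        simp only [Set.mem_ofPred, inner_add_right]
        exact ⟨hv.add hw, C + C', fun y => (abs_add_le _ _).trans (add_le_add (hC y) (hC' y))⟩
      zero_mem' := by
        simp only [Set.mem_ofPred, inner_zero_right]
        exact ⟨measurable_const, 0, fun y => by simp⟩
      smul_mem' := by
        rintro a v ⟨hv, C, hC⟩
        simp only [Set.mem_ofPred, inner_smul_right]
        refine ⟨hv.const_mul a, |a| * C, fun y => ?_⟩
        rw [abs_mul]
        exact mul_le_mul_of_nonneg_left (hC y) (abs_nonneg _) }
  have hsub : Submodule.span ℝ (tangentConeAt ℝ X x) ≤ W := Submodule.span_le.2 fun v hv =>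
    ⟨(inner_costGrad_of_tangent hc hv).1, _, (inner_costGrad_of_tangent hc hv).2⟩
  have hW : Dense (W : Set (E d)) := (hXd x x.2).dense_tangentConeAt.mono hsub
  have : v ∈ (W : Set (E d)) := by
    rw [← (W.closed_of_finiteDimensional).closure_eq]
    exact hW v
  exact this

lemma costGrad_eq_sum (x y : X) : costGrad c x y =
    ∑ i, inner ℝ (costGrad c x y) (EuclideanSpace.basisFun (Fin d) ℝ i) •
      EuclideanSpace.basisFun (Fin d) ℝ i := by
  conv_lhs => rw [← (EuclideanSpace.basisFun (Fin d) ℝ).sum_repr' (costGrad c x y)]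
  simp only [real_inner_comm]

lemma measurable_costGrad (hXd : UniqueDiffOn ℝ X) (hc : CostAssumption c Mc Gc Lc) (x : X) :
    Measurable (costGrad c x) := by
  rw [funext (costGrad_eq_sum x)]
  exact Finset.measurable_sum _ fun i _ => (inner_costGrad hXd hc x _).1.smul_const _

lemma continuous_costGrad (hc : CostAssumption c Mc Gc Lc) (y : X) :
    Continuous (fun x => costGrad c x y) := by
  refine (LipschitzWith.of_dist_le_mul (K := |Lc|.toNNReal) fun x x' => ?_).continuous
  rw [Real.coe_toNNReal _ (abs_nonneg _), dist_eq_norm, Subtype.dist_eq, dist_eq_norm]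
  exact (hc.smooth x x' y).trans (mul_le_mul_of_nonneg_right (le_abs_self _) (norm_nonneg _))

/-- A Carathéodory function, continuous in the first variable and measurable in the second, is
jointly measurable. -/
lemma stronglyMeasurable_costGrad (hXd : UniqueDiffOn ℝ X) (hc : CostAssumption c Mc Gc Lc) :
    StronglyMeasurable (fun z : X × X => costGrad c z.1 z.2) :=
  stronglyMeasurable_uncurry_of_continuous_of_stronglyMeasurable
    (continuous_costGrad hc) (fun x => (measurable_costGrad hXd hc x).stronglyMeasurable)

/-- Coordinates bound the gradient at one base point uniformly in `y`; smoothness and boundedness of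
`X` carry the bound to all `x`. -/
lemma exists_norm_costGrad_le [CompactSpace X] (hXd : UniqueDiffOn ℝ X)
    (hc : CostAssumption c Mc Gc Lc) : ∃ C, 0 ≤ C ∧ ∀ x y, ‖costGrad c x y‖ ≤ C := by
  rcases isEmpty_or_nonempty X with hX | ⟨⟨x₀⟩⟩
  · exact ⟨0, le_rfl, fun x => isEmptyElim x⟩
  choose C hC using fun i => (inner_costGrad hXd hc x₀ (EuclideanSpace.basisFun (Fin d) ℝ i)).2
  obtain ⟨R, hR⟩ := isCompact_univ.exists_bound_of_continuousOn
    (f := fun x : X => (x : E d) - x₀) (by fun_prop)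
  have h0 : ∀ y, ‖costGrad c x₀ y‖ ≤ ∑ i, C i := fun y => by
    rw [costGrad_eq_sum]
    refine (norm_sum_le _ _).trans (Finset.sum_le_sum fun i _ => ?_)
    rw [norm_smul, OrthonormalBasis.norm_eq_one, mul_one]
    exact hC i y
  refine ⟨|Lc| * R + ∑ i, C i, ?_, fun x y => ?_⟩
  · exact add_nonneg (mul_nonneg (abs_nonneg _) ((norm_nonneg _).trans (hR x₀ trivial)))
      ((norm_nonneg _).trans (h0 x₀))
  · calc ‖costGrad c x y‖ = ‖(costGrad c x y - costGrad c x₀ y) + costGrad c x₀ y‖ := by simp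
      _ ≤ ‖costGrad c x y - costGrad c x₀ y‖ + ‖costGrad c x₀ y‖ := norm_add_le _ _
      _ ≤ |Lc| * R + ∑ i, C i := by
        refine add_le_add ((hc.smooth x x₀ y).trans ?_) (h0 y)
        exact mul_le_mul (le_abs_self _) (hR x trivial) (norm_nonneg _) (abs_nonneg _)

/-- Differentiation under the integral sign, within a set. -/
lemma hasGradientWithinAt_integral {V Y : Type*} [NormedAddCommGroup V] [InnerProductSpace ℝ V]
    [CompleteSpace V] [MeasurableSpace Y] {μ : Measure Y} [IsFiniteMeasure μ]
    {F : V → Y → ℝ} {F' : Y → V} {s : Set V} {x : V} {K : ℝ} (hx : x ∈ s)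
    (hF : ∀ z ∈ s, Integrable (F z) μ) (hK : ∀ z ∈ s, ∀ y, |F z y - F x y| ≤ K * ‖z - x‖)
    (hF' : Integrable F' μ) (h : ∀ y, HasGradientWithinAt (F · y) (F' y) s x) :
    HasGradientWithinAt (fun z => ∫ y, F z y ∂μ) (∫ y, F' y ∂μ) s x := by
  rw [hasGradientWithinAt_iff_tendsto]
  have key : Tendsto (fun z => ∫ y, ‖z - x‖⁻¹ * (F z y - F x y - inner ℝ (F' y) (z - x)) ∂μ)
      (𝓝[s] x) (𝓝 (∫ y, (0 : ℝ) ∂μ)) := by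
    refine tendsto_integral_filter_of_dominated_convergence (fun y => |K| + ‖F' y‖) ?_ ?_
      ((integrable_const _).add hF'.norm) (ae_of_all _ fun y => ?_)
    · filter_upwards [self_mem_nhdsWithin] with z hz
      exact ((((hF z hz).sub (hF x hx)).sub (hF'.inner_const _)).const_mul _).aestronglyMeasurable
    · filter_upwards [self_mem_nhdsWithin] with z hz
      refine ae_of_all _ fun y => ?_
      rw [norm_mul, norm_inv, norm_norm]
      -- At `z = x` the quotient is 0, by the convention `0⁻¹ = 0`.
      rcases (norm_nonneg (z - x)).eq_or_lt with h0 | h0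
      · rw [← h0]
        simpa using add_nonneg (abs_nonneg K) (norm_nonneg (F' y))
      rw [inv_mul_le_iff₀ h0]
      refine (norm_sub_le _ _).trans ?_
      have h1 := hK z hz y
      have h2 : K * ‖z - x‖ ≤ |K| * ‖z - x‖ := by gcongr; exact le_abs_self K
      have h3 := norm_inner_le_norm (𝕜 := ℝ) (F' y) (z - x)
      rw [Real.norm_eq_abs]
      linarith
    · rw [tendsto_zero_iff_norm_tendsto_zero]
      simpa only [norm_mul, norm_inv, norm_norm] using hasGradientWithinAt_iff_tendsto.1 (h y)
  rw [integral_zero, tendsto_zero_iff_norm_tendsto_zero] at key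
  refine key.congr' ?_
  filter_upwards [self_mem_nhdsWithin] with z hz
  have hsub : Integrable (fun y => F z y - F x y) μ := (hF z hz).sub (hF x hx)
  rw [integral_const_mul, norm_mul, norm_inv, norm_norm,
    integral_sub hsub (hF'.inner_const _),
    integral_sub (hF z hz) (hF x hx)]
  congr 4
  simp only [real_inner_comm (z - x)]
  exact integral_inner (𝕜 := ℝ) hF' _

lemma abs_exp_sub_exp_le {a b M : ℝ} (ha : Real.exp a ≤ M) (hb : Real.exp b ≤ M) :
    |Real.exp a - Real.exp b| ≤ M * |a - b| := by
  have key : ∀ a b : ℝ, Real.exp a ≤ M → Real.exp a - Real.exp b ≤ M * |a - b| := by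
    intro a b ha
    have h1 := mul_le_mul_of_nonneg_left (Real.add_one_le_exp (b - a)) (Real.exp_pos a).le
    rw [← Real.exp_add, add_sub_cancel] at h1
    calc Real.exp a - Real.exp b ≤ Real.exp a * (a - b) := by linarith
      _ ≤ Real.exp a * |a - b| := by gcongr; exact le_abs_self _
      _ ≤ M * |a - b| := by gcongr
  rw [abs_le]
  have := key b a hb
  rw [abs_sub_comm] at this
  exact ⟨by linarith, key a b ha⟩

variable [CompactSpace X] {α β : Measure X} [IsProbabilityMeasure α] [IsProbabilityMeasure β]
  {f g : C(X, ℝ)}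

lemma integrable_gibbs_smul_costGrad (hXd : UniqueDiffOn ℝ X) (hc : CostAssumption c Mc Gc Lc)
    (x : X) : Integrable (fun y => gibbs γ c f g (x, y) • costGrad c x y) β := by
  obtain ⟨C, -, hC⟩ := exists_norm_costGrad_le hXd hc
  have hg : Continuous fun y => gibbs γ c f g (x, y) :=
    (continuous_gibbs hc.continuous f.continuous g.continuous).comp (Continuous.prodMk_right x)
  have := Integrable.of_bound (μ := β) (measurable_costGrad hXd hc x).aestronglyMeasurable C
    (ae_of_all _ (hC x))
  obtain ⟨M, hM⟩ := isCompact_univ.exists_bound_of_continuousOn hg.continuousOn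
  exact this.bdd_smul M hg.aestronglyMeasurable (ae_of_all _ fun y => hM y trivial)

/-- The gradient of a Sinkhorn potential. -/
lemma hasGradientWithinAt_potential (hXd : UniqueDiffOn ℝ X) (hγ : 0 < γ)
    (hc : CostAssumption c Mc Gc Lc) (hf : ∀ x, f x = sinkhornMap γ c g β x) (x : X) :
    HasGradientWithinAt (extZero f) (∫ y, gibbs γ c f g (x, y) • costGrad c x y ∂β) X x := by
  have hcc := hc.continuous
  have hint := integrable_gibbs_smul_costGrad (β := β) (γ := γ) (f := f) (g := g) hXd hc x
  have hcont : Continuous (fun z : X × X => Real.exp ((g z.2 - c z.1 z.2) / γ)) := by fun_prop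
  obtain ⟨M, hM⟩ := isCompact_univ.exists_bound_of_continuousOn hcont.continuousOn
  have hM' : ∀ z y, Real.exp ((g y - c z y) / γ) ≤ M := fun z y =>
    (le_abs_self _).trans (hM (z, y) trivial)
  set F : E d → X → ℝ := fun z y => Real.exp ((g y - extZero (fun z => c z y) z) / γ) with hFdef
  have hFX : ∀ (z : X) y, F z y = Real.exp ((g y - c z y) / γ) := fun z y => by
    rw [hFdef]; simp only [extZero_apply]
  have hI : ∀ z : X, ∫ y, F z y ∂β = Real.exp (-f z / γ) := fun z => by
    simp only [hFX]
    rw [hf, exp_neg_sinkhornMap β hγ hcc g.continuous]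
    simp only [hc.symm z]
  -- `F x` is `gibbs` times `exp (-f x / γ)`; this factor later cancels against the derivative of
  -- `-γ log` at `∫ F = exp (-f x / γ)`.
  have hF' : ∀ y, (-(γ⁻¹ * Real.exp (-f x / γ))) • (gibbs γ c f g (x, y) • costGrad c x y) =
      (-(γ⁻¹ * F x y)) • costGrad c x y := fun y => by
    rw [smul_smul, hFX]
    congr 1
    rw [neg_mul, mul_assoc, gibbs, ← Real.exp_add]
    ring_nf
  have hgrad : HasGradientWithinAt (fun z => ∫ y, F z y ∂β)
      ((-(γ⁻¹ * Real.exp (-f x / γ))) • ∫ y, gibbs γ c f g (x, y) • costGrad c x y ∂β) X x := by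
    have hint' : Integrable (fun y => (-(γ⁻¹ * Real.exp (-f x / γ))) •
        (gibbs γ c f g (x, y) • costGrad c x y)) β :=
      hint.smul (-(γ⁻¹ * Real.exp (-f x / γ)))
    rw [← integral_smul]
    refine hasGradientWithinAt_integral (K := M * (γ⁻¹ * |Gc|)) x.2 (fun z hz => ?_)
      (fun z hz y => ?_) hint' fun y => ?_
    · rw [show F z = fun y => Real.exp ((g y - c ⟨z, hz⟩ y) / γ) from funext (hFX ⟨z, hz⟩)]
      exact integrable_of_continuous (by fun_prop)
    · rw [hFX ⟨z, hz⟩, hFX x]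
      refine (abs_exp_sub_exp_le (hM' _ _) (hM' _ _)).trans ?_
      rw [mul_assoc]
      have hM0 : 0 ≤ M := (Real.exp_pos _).le.trans (hM' x y)
      refine mul_le_mul_of_nonneg_left ?_ hM0
      rw [← sub_div, abs_div, abs_of_pos hγ, div_eq_inv_mul, mul_assoc]
      refine mul_le_mul_of_nonneg_left ?_ (inv_nonneg.2 hγ.le)
      have := hc.abs_sub_le x ⟨z, hz⟩ y
      rw [dist_comm, Subtype.dist_eq, dist_eq_norm] at this
      rwa [show g y - c ⟨z, hz⟩ y - (g y - c x y) = c x y - c ⟨z, hz⟩ y by ring]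
    · rw [hF' y]
      have h1 := (((hasGradientWithinAt_cost hc x y).hasFDerivWithinAt.const_sub (g y)).mul_const
        γ⁻¹).exp
      rw [hasGradientWithinAt_iff_hasFDerivWithinAt]
      simp only [← div_eq_mul_inv] at h1
      refine h1.congr_fderiv ?_
      rw [map_smul, smul_neg, smul_neg, smul_smul, neg_smul, mul_comm]
  have hlog := (hgrad.hasFDerivWithinAt.log (by rw [hI]; exact (Real.exp_pos _).ne')).const_mul (-γ)
  rw [hasGradientWithinAt_iff_hasFDerivWithinAt]
  have hcongr : ∀ z ∈ X, extZero f z = -γ * Real.log (∫ y, F z y ∂β) := fun z hz => by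
    rw [extZero_of_mem _ hz, hI ⟨z, hz⟩, Real.log_exp]
    field_simp
  refine (hlog.congr hcongr (hcongr x x.2)).congr_fderiv ?_
  rw [hI, map_smul, smul_smul, smul_smul]
  have : -γ * (Real.exp (-f x / γ))⁻¹ * -(γ⁻¹ * Real.exp (-f x / γ)) = 1 := by
    have := (Real.exp_pos (-f x / γ)).ne'
    field_simp
  rw [this, one_smul]

lemma grad_potential_eq (hXd : UniqueDiffOn ℝ X) (hγ : 0 < γ)
    (hc : CostAssumption c Mc Gc Lc) (hf : ∀ x, f x = sinkhornMap γ c g β x) (x : X) :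
    grad f x = ∫ y, gibbs γ c f g (x, y) • costGrad c x y ∂β :=
  grad_eq_of_hasGradientWithinAt hXd (hasGradientWithinAt_potential hXd hγ hc hf x)

lemma continuous_grad_potential (hXd : UniqueDiffOn ℝ X) (hγ : 0 < γ)
    (hc : CostAssumption c Mc Gc Lc) (hf : ∀ x, f x = sinkhornMap γ c g β x) :
    Continuous (grad f) := by
  rw [funext (grad_potential_eq hXd hγ hc hf)]
  have hg := continuous_gibbs (γ := γ) hc.continuous f.continuous g.continuous
  obtain ⟨C, hC0, hC⟩ := exists_norm_costGrad_le hXd hc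
  obtain ⟨M, hM⟩ := isCompact_univ.exists_bound_of_continuousOn hg.continuousOn
  refine continuous_of_dominated (bound := fun _ => M * C)
    (fun x => (integrable_gibbs_smul_costGrad hXd hc x).aestronglyMeasurable)
    (fun x => ae_of_all _ fun y => ?_) (integrable_const _) (ae_of_all _ fun y => ?_)
  · rw [norm_smul]
    exact mul_le_mul (hM _ trivial) (hC x y) (norm_nonneg _)
      ((norm_nonneg _).trans (hM (x, y) trivial))
  · exact (hg.comp (Continuous.prodMk_left y)).smul (continuous_costGrad hc y)

end Gradient

/-! ### Derivatives along segments in `X`. -/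

section Displacement

variable {c : X → X → ℝ} {Mc Gc Lc γ : ℝ} {u v : X → E d}

open Classical in
/-- The displacement `x ↦ x + s u(x)`, with the points that would leave `X` kept in place. -/
noncomputable def move (u : X → E d) (s : ℝ) (x : X) : X :=
  ⟨if (x : E d) + s • u x ∈ X then (x : E d) + s • u x else x, by
    split_ifs with h
    exacts [h, x.2]⟩

lemma move_of_mem {s : ℝ} {x : X} (h : (x : E d) + s • u x ∈ X) :
    move u s x = ⟨(x : E d) + s • u x, h⟩ := by
  simp [move, h]

lemma move_zero (u : X → E d) (x : X) : move u 0 x = x := by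
  simp [move]

lemma dist_move_le (u : X → E d) (s : ℝ) (x : X) : dist (move u s x) x ≤ |s| * ‖u x‖ := by
  rw [Subtype.dist_eq, move]
  split_ifs with h
  · rw [dist_eq_norm, add_sub_cancel_left, norm_smul, Real.norm_eq_abs]
  · rw [dist_self]
    positivity

lemma measurable_move (hX : MeasurableSet X) (hu : Measurable u) (s : ℝ) :
    Measurable (move u s) := by
  have h : Measurable (fun x : X => (x : E d) + s • u x) :=
    measurable_subtype_coe.add (hu.const_smul s)
  exact (Measurable.ite (h hX) h measurable_subtype_coe).subtype_mk

lemma tendsto_move (u : X → E d) (x : X) :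
    Tendsto (fun s => move u s x) (𝓝[>] 0) (𝓝 x) := by
  rw [tendsto_iff_dist_tendsto_zero]
  refine squeeze_zero (fun s => dist_nonneg) (fun s => dist_move_le u s x) ?_
  have : Tendsto (fun s : ℝ => |s| * ‖u x‖) (𝓝 0) (𝓝 (|0| * ‖u x‖)) :=
    Continuous.tendsto (by fun_prop) 0
  simp only [abs_zero, zero_mul] at this
  exact this.mono_left nhdsWithin_le_nhds

/-- The segment from `x` to `x + r u(x)` lies in `X`. -/
def SegmentIn (X : Set (E d)) (u : X → E d) (r : ℝ) (x : X) : Prop :=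
  ∀ s ∈ Set.Icc 0 r, (x : E d) + s • u x ∈ X

lemma hasDerivWithinAt_move {h : X → ℝ} {r t : ℝ} {x : X} (hx : SegmentIn X u r x)
    (ht : t ∈ Set.Icc 0 r) {p : E d} (hp : HasGradientWithinAt (extZero h) p X (move u t x)) :
    HasDerivWithinAt (fun s => h (move u s x)) (inner ℝ p (u x)) (Set.Icc 0 r) t := by
  have h1 : HasDerivWithinAt (fun s : ℝ => (x : E d) + s • u x) (u x) (Set.Icc 0 r) t := by
    simpa using ((hasDerivAt_id t).smul_const (u x)).const_add (x : E d) |>.hasDerivWithinAt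
  have hpt : ((move u t x : X) : E d) = (x : E d) + t • u x := by rw [move_of_mem (hx t ht)]
  rw [hpt] at hp
  have h2 := hp.hasFDerivWithinAt.comp_hasDerivWithinAt t h1 hx
  have hcongr : ∀ s ∈ Set.Icc 0 r,
      h (move u s x) = (extZero h ∘ fun s : ℝ => (x : E d) + s • u x) s := fun s hs => by
    rw [Function.comp_apply, extZero_of_mem h (hx s hs), move_of_mem (hx s hs)]
  exact h2.congr hcongr (hcongr t ht)

lemma hasDerivWithinAt_move_zero {h : X → ℝ} {r : ℝ} {x : X} (hr : 0 < r)
    (hx : SegmentIn X u r x) {p : E d} (hp : HasGradientWithinAt (extZero h) p X x) :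
    HasDerivWithinAt (fun s => h (move u s x)) (inner ℝ p (u x)) (Set.Ioi 0) 0 := by
  have h1 := hasDerivWithinAt_move (t := 0) hx ⟨le_rfl, hr.le⟩ (by rwa [move_zero])
  exact (h1.mono Set.Ioc_subset_Icc_self).mono_of_mem_nhdsWithin (Ioc_mem_nhdsGT hr)

/-- A first-order expansion of the cost along segments in `X`, uniform in the second variable. -/
lemma abs_cost_move_sub_le (hc : CostAssumption c Mc Gc Lc) {r s : ℝ} {x : X}
    (hx : SegmentIn X u r x) (hs : s ∈ Set.Icc 0 r) (y : X) :
    |c (move u s x) y - c x y - s * inner ℝ (costGrad c x y) (u x)| ≤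
      |Lc| * ‖u x‖ ^ 2 * s ^ 2 := by
  have hsub : Set.Icc 0 s ⊆ Set.Icc 0 r := Set.Icc_subset_Icc_right hs.2
  -- Mean value inequality for the cost minus its linear part: by smoothness the derivative is at
  -- most `|Lc| * ‖u x‖ ^ 2 * s`, over an interval of length `s`.
  have hd : ∀ t ∈ Set.Icc 0 s, HasDerivWithinAt
      (fun t => c (move u t x) y - t * inner ℝ (costGrad c x y) (u x))
      (inner ℝ (costGrad c (move u t x) y) (u x) - 1 * inner ℝ (costGrad c x y) (u x))
      (Set.Icc 0 s) t := fun t ht =>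
    ((hasDerivWithinAt_move hx (hsub ht) (hasGradientWithinAt_cost hc (move u t x) y)).mono
      hsub).sub ((hasDerivWithinAt_id t _).mul_const _)
  have hb : ∀ t ∈ Set.Icc 0 s, ‖inner ℝ (costGrad c (move u t x) y) (u x) -
      1 * inner ℝ (costGrad c x y) (u x)‖ ≤ |Lc| * ‖u x‖ ^ 2 * s := fun t ht => by
    rw [one_mul, ← inner_sub_left]
    refine (norm_inner_le_norm _ _).trans ?_
    have h1 : ‖costGrad c (move u t x) y - costGrad c x y‖ ≤ |Lc| * (s * ‖u x‖) := by
      refine (hc.smooth _ _ y).trans ?_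
      have h2 := dist_move_le u t x
      rw [Subtype.dist_eq, dist_eq_norm, abs_of_nonneg ht.1] at h2
      exact mul_le_mul (le_abs_self _) (h2.trans (by gcongr; exact ht.2)) (norm_nonneg _)
        (abs_nonneg _)
    calc _ ≤ |Lc| * (s * ‖u x‖) * ‖u x‖ := by gcongr
      _ = _ := by ring
  have := (convex_Icc 0 s).norm_image_sub_le_of_norm_hasDerivWithin_le hd hb
    ⟨le_rfl, hs.1⟩ ⟨hs.1, le_rfl⟩
  simp only [move_zero, zero_mul, sub_zero, Real.norm_eq_abs, abs_of_nonneg hs.1] at this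
  calc _ = |c (move u s x) y - s * inner ℝ (costGrad c x y) (u x) - c x y| := by ring_nf
    _ ≤ _ := this
    _ = _ := by ring

lemma abs_slope_cost_move_sub_le (hc : CostAssumption c Mc Gc Lc) {r s : ℝ} {x : X}
    (hx : SegmentIn X u r x) (hs : s ∈ Set.Ioc 0 r) (y : X) :
    |s⁻¹ * (c (move u s x) y - c x y) - inner ℝ (costGrad c x y) (u x)| ≤
      |Lc| * ‖u x‖ ^ 2 * s := by
  have h := abs_cost_move_sub_le hc hx ⟨hs.1.le, hs.2⟩ y
  have h1 : s⁻¹ * (c (move u s x) y - c x y) - inner ℝ (costGrad c x y) (u x) =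
      s⁻¹ * (c (move u s x) y - c x y - s * inner ℝ (costGrad c x y) (u x)) := by
    have := hs.1.ne'
    field_simp
  rw [h1, abs_mul, abs_of_pos (inv_pos.2 hs.1), inv_mul_le_iff₀ hs.1]
  linarith

/-- The difference quotients are continuous in `y` and converge uniformly in `y`. This continuity,
not assumed of the cost, is what allows the second point to move as well. -/
lemma continuous_inner_costGrad (hc : CostAssumption c Mc Gc Lc) {r : ℝ} (hr : 0 < r) {x : X}
    (hx : SegmentIn X u r x) : Continuous (fun y => inner ℝ (costGrad c x y) (u x)) := by
  have hlim : Tendsto (fun s : ℝ => |Lc| * ‖u x‖ ^ 2 * s) (𝓝[>] 0) (𝓝 0) := by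
    have : Tendsto (fun s : ℝ => |Lc| * ‖u x‖ ^ 2 * s) (𝓝 0) (𝓝 (|Lc| * ‖u x‖ ^ 2 * 0)) :=
      Continuous.tendsto (by fun_prop) 0
    rw [mul_zero] at this
    exact this.mono_left nhdsWithin_le_nhds
  have hu : TendstoUniformly (fun (s : ℝ) y => s⁻¹ * (c (move u s x) y - c x y))
      (fun y => inner ℝ (costGrad c x y) (u x)) (𝓝[>] 0) := by
    rw [Metric.tendstoUniformly_iff]
    intro ε hε
    filter_upwards [Ioc_mem_nhdsGT hr, hlim.eventually (gt_mem_nhds hε)] with s hs hsε y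
    rw [dist_comm, Real.dist_eq]
    exact (abs_slope_cost_move_sub_le hc hx hs y).trans_lt hsε
  refine hu.continuous (Eventually.of_forall fun s => ?_).frequently
  have h1 : ∀ z, Continuous (c z) := fun z => hc.continuous.comp (Continuous.prodMk_right z)
  have := h1 (move u s x)
  have := h1 x
  fun_prop

/-- The joint derivative of the cost when both points move along segments in `X`. -/
lemma hasDerivWithinAt_cost_move (hc : CostAssumption c Mc Gc Lc) {r : ℝ} (hr : 0 < r) {x y : X}
    (hx : SegmentIn X u r x) (hy : SegmentIn X v r y) :
    HasDerivWithinAt (fun s => c (move u s x) (move v s y))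
      (inner ℝ (costGrad c x y) (u x) + inner ℝ (costGrad c y x) (v y)) (Set.Ioi 0) 0 := by
  rw [hasDerivWithinAt_iff_tendsto_slope' (by simp)]
  have hlim : Tendsto (fun s : ℝ => |Lc| * ‖u x‖ ^ 2 * s) (𝓝[>] 0) (𝓝 0) := by
    have : Tendsto (fun s : ℝ => |Lc| * ‖u x‖ ^ 2 * s) (𝓝 0) (𝓝 (|Lc| * ‖u x‖ ^ 2 * 0)) :=
      Continuous.tendsto (by fun_prop) 0
    rw [mul_zero] at this
    exact this.mono_left nhdsWithin_le_nhds
  -- Move one point at a time. With the second point at its displaced position, the expansion in the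
  -- first is uniform in it; the remaining increment, by symmetry, is a derivative in a first
  -- argument.
  have h1 : Tendsto (fun s : ℝ => s⁻¹ * (c (move u s x) (move v s y) - c x (move v s y)) -
      inner ℝ (costGrad c x (move v s y)) (u x)) (𝓝[>] 0) (𝓝 0) := by
    refine squeeze_zero_norm' ?_ hlim
    filter_upwards [Ioc_mem_nhdsGT hr] with s hs
    exact abs_slope_cost_move_sub_le hc hx hs _
  have h2 : Tendsto (fun s : ℝ => inner ℝ (costGrad c x (move v s y)) (u x)) (𝓝[>] 0)
      (𝓝 (inner ℝ (costGrad c x y) (u x))) :=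
    ((continuous_inner_costGrad hc hr hx).tendsto y).comp (tendsto_move v y)
  have h3 := hasDerivWithinAt_move_zero hr hy (hasGradientWithinAt_cost hc y x)
  rw [hasDerivWithinAt_iff_tendsto_slope' (by simp)] at h3
  have h4 := (h1.add h2).add h3
  rw [zero_add] at h4
  refine h4.congr fun s => ?_
  simp only [slope_def_field, move_zero, sub_zero, hc.symm (move v s y) x, hc.symm y x]
  ring

end Displacement

/-! ### The envelope theorem for displaced marginals. -/

section Envelope

/-- Dominated differentiation of an integral from the right. -/
lemma hasDerivWithinAt_integral {Y : Type*} [MeasurableSpace Y] {μ : Measure Y}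
    [IsFiniteMeasure μ] {G : ℝ → Y → ℝ} {G' : Y → ℝ} {K : ℝ} (hG : ∀ s, Integrable (G s) μ)
    (hK : ∀ s y, |G s y - G 0 y| ≤ K * |s|)
    (h : ∀ᵐ y ∂μ, HasDerivWithinAt (fun s => G s y) (G' y) (Set.Ioi 0) 0) :
    HasDerivWithinAt (fun s => ∫ y, G s y ∂μ) (∫ y, G' y ∂μ) (Set.Ioi 0) 0 := by
  rw [hasDerivWithinAt_iff_tendsto_slope' (by simp)]
  have key : Tendsto (fun s : ℝ => ∫ y, (G s y - G 0 y) / s ∂μ) (𝓝[>] 0)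
      (𝓝 (∫ y, G' y ∂μ)) := by
    refine tendsto_integral_filter_of_dominated_convergence (fun _ => K) ?_ ?_
      (integrable_const _) ?_
    · exact Eventually.of_forall fun s => (((hG s).sub (hG 0)).div_const s).aestronglyMeasurable
    · filter_upwards [self_mem_nhdsWithin] with s hs
      refine ae_of_all _ fun y => ?_
      rw [Real.norm_eq_abs, abs_div, div_le_iff₀ (abs_pos.2 (ne_of_gt hs))]
      exact hK s y
    · filter_upwards [h] with y hy
      rw [hasDerivWithinAt_iff_tendsto_slope' (by simp)] at hy
      exact hy.congr fun s => by rw [slope_def_field, sub_zero]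
  refine key.congr fun s => ?_
  rw [slope_def_field, sub_zero, integral_div, integral_sub (hG s) (hG 0)]

/-- A function between two functions with the same right derivative has that derivative. -/
lemma hasDerivWithinAt_of_squeeze {L V U : ℝ → ℝ} {a : ℝ} (hLV : ∀ s, L s ≤ V s)
    (hVU : ∀ s, V s ≤ U s) (h0 : L 0 = U 0) (hL : HasDerivWithinAt L a (Set.Ioi 0) 0)
    (hU : HasDerivWithinAt U a (Set.Ioi 0) 0) : HasDerivWithinAt V a (Set.Ioi 0) 0 := by
  rw [hasDerivWithinAt_iff_tendsto_slope' (by simp)] at hL hU ⊢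
  have h1 : L 0 = V 0 := le_antisymm (hLV 0) (h0 ▸ hVU 0)
  refine tendsto_of_tendsto_of_tendsto_of_le_of_le' hL hU ?_ ?_ <;>
    filter_upwards [self_mem_nhdsWithin] with s hs <;>
    simp only [slope_def_field, sub_zero] <;>
    have hs' : (0 : ℝ) < s := hs <;> gcongr
  · exact hLV s
  · exact h1.ge
  · exact hVU s
  · exact (h0 ▸ h1).le

lemma stronglyMeasurable_inner_costGrad {c : X → X → ℝ} {Mc Gc Lc : ℝ} {u : X → E d}
    (hXd : UniqueDiffOn ℝ X)
    (hc : CostAssumption c Mc Gc Lc) (hu : Continuous u) :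
    StronglyMeasurable (fun z : X × X => inner ℝ (costGrad c z.1 z.2) (u z.1)) :=
  (stronglyMeasurable_costGrad hXd hc).inner (hu.comp continuous_fst).stronglyMeasurable

variable {c : X → X → ℝ} {Mc Gc Lc γ : ℝ} [CompactSpace X] {α β : Measure X}
  [IsProbabilityMeasure α] [IsProbabilityMeasure β] {f g : C(X, ℝ)} {u v : X → E d}

lemma integral_gibbs_mul_left (hγ : 0 < γ) (hc : CostAssumption c Mc Gc Lc)
    (hf : ∀ x, f x = sinkhornMap γ c g β x) {h : X → ℝ} (hh : Continuous h) :
    ∫ z, gibbs γ c f g z * h z.1 ∂(α.prod β) = ∫ x, h x ∂α := by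
  have hg := continuous_gibbs (γ := γ) hc.continuous f.continuous g.continuous
  rw [integral_prod _ (integrable_of_continuous (by fun_prop))]
  refine integral_congr_ae (ae_of_all _ fun x => ?_)
  simp only [integral_mul_const, integral_gibbs_right_eq_one hγ hc.continuous hc.symm hf, one_mul]

lemma integrable_gibbs_mul_inner_costGrad (hXd : UniqueDiffOn ℝ X)
    (hc : CostAssumption c Mc Gc Lc) (hu : Continuous u) :
    Integrable (fun z : X × X => gibbs γ c f g z * inner ℝ (costGrad c z.1 z.2) (u z.1))
      (α.prod β) := by
  have hg := continuous_gibbs (γ := γ) hc.continuous f.continuous g.continuous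
  obtain ⟨C, hC0, hC⟩ := exists_norm_costGrad_le hXd hc
  obtain ⟨B, hB⟩ := isCompact_univ.exists_bound_of_continuousOn hu.continuousOn
  obtain ⟨M, hM⟩ := isCompact_univ.exists_bound_of_continuousOn hg.continuousOn
  refine Integrable.bdd_mul (c := M) ?_ hg.aestronglyMeasurable (ae_of_all _ fun z => hM z trivial)
  refine Integrable.of_bound (stronglyMeasurable_inner_costGrad hXd hc hu).aestronglyMeasurable
    (C * B) (ae_of_all _ fun z => (norm_inner_le_norm _ _).trans ?_)
  exact mul_le_mul (hC _ _) (hB _ trivial) (norm_nonneg _) hC0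

/-- By Fubini the inner integral is the formula for `grad f x`. This identity makes the primal and
dual derivatives coincide. -/
lemma integral_gibbs_mul_inner_costGrad (hXd : UniqueDiffOn ℝ X) (hγ : 0 < γ)
    (hc : CostAssumption c Mc Gc Lc) (hf : ∀ x, f x = sinkhornMap γ c g β x)
    (hu : Continuous u) :
    ∫ z, gibbs γ c f g z * inner ℝ (costGrad c z.1 z.2) (u z.1) ∂(α.prod β) =
      ∫ x, inner ℝ (grad f x) (u x) ∂α := by
  rw [integral_prod _ (integrable_gibbs_mul_inner_costGrad hXd hc hu)]
  refine integral_congr_ae (ae_of_all _ fun x => ?_)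
  simp only
  rw [grad_potential_eq hXd hγ hc hf x, real_inner_comm,
    ← integral_inner (𝕜 := ℝ) (integrable_gibbs_smul_costGrad hXd hc x)]
  refine integral_congr_ae (ae_of_all _ fun y => ?_)
  simp only [real_inner_smul_right, real_inner_comm]

lemma integral_gibbs_mul_right (hγ : 0 < γ) (hc : CostAssumption c Mc Gc Lc)
    (hg : ∀ y, g y = sinkhornMap γ c f α y) {h : X → ℝ} (hh : Continuous h) :
    ∫ z, gibbs γ c f g z * h z.2 ∂(α.prod β) = ∫ y, h y ∂β := by
  rw [← integral_gibbs_mul_left (α := β) hγ hc hg hh, ← integral_prod_swap]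
  simp only [gibbs_swap hc.symm, Prod.snd_swap]

lemma integrable_gibbs_mul_inner_costGrad_swap (hXd : UniqueDiffOn ℝ X)
    (hc : CostAssumption c Mc Gc Lc) (hv : Continuous v) :
    Integrable (fun z : X × X => gibbs γ c f g z * inner ℝ (costGrad c z.2 z.1) (v z.2))
      (α.prod β) := by
  have := (integrable_gibbs_mul_inner_costGrad (α := β) (β := α) (γ := γ) (f := g) (g := f)
    hXd hc hv).swap
  simpa only [Function.comp_def, gibbs_swap hc.symm, Prod.fst_swap, Prod.snd_swap] using this

lemma integral_gibbs_mul_inner_costGrad_swap (hXd : UniqueDiffOn ℝ X) (hγ : 0 < γ)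
    (hc : CostAssumption c Mc Gc Lc) (hg : ∀ y, g y = sinkhornMap γ c f α y)
    (hv : Continuous v) :
    ∫ z, gibbs γ c f g z * inner ℝ (costGrad c z.2 z.1) (v z.2) ∂(α.prod β) =
      ∫ y, inner ℝ (grad g y) (v y) ∂β := by
  rw [← integral_gibbs_mul_inner_costGrad (α := β) hXd hγ hc hg hv, ← integral_prod_swap]
  simp only [gibbs_swap hc.symm, Prod.fst_swap, Prod.snd_swap]

lemma integrable_comp_of_continuous {Y Z : Type*} [TopologicalSpace Y] [CompactSpace Y]
    [MeasurableSpace Y] [OpensMeasurableSpace Y] [MeasurableSpace Z] {μ : Measure Z}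
    [IsFiniteMeasure μ] {h : Y → ℝ} (hh : Continuous h) {T : Z → Y} (hT : Measurable T) :
    Integrable (fun z => h (T z)) μ := by
  obtain ⟨C, hC⟩ := isCompact_univ.exists_bound_of_continuousOn hh.continuousOn
  exact Integrable.of_bound (hh.measurable.comp hT).aestronglyMeasurable C
    (ae_of_all _ fun x => hC _ trivial)

/-- The right derivative of the regularised transport cost when both marginals are displaced
along velocity fields that point into `X`. -/
theorem hasDerivWithinAt_OT_move (hXd : UniqueDiffOn ℝ X) (hγ : 0 < γ)
    (hc : CostAssumption c Mc Gc Lc) (hf : ∀ x, f x = sinkhornMap γ c g β x)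
    (hg : ∀ y, g y = sinkhornMap γ c f α y) (hu : Continuous u) (hv : Continuous v) {r : ℝ}
    (hr : 0 < r) (hαu : ∀ᵐ x ∂α, SegmentIn X u r x) (hβv : ∀ᵐ y ∂β, SegmentIn X v r y) :
    HasDerivWithinAt
      (fun s => (OT γ c (incl (α.map (move u s))) (incl (β.map (move v s)))).toReal)
      (∫ x, inner ℝ (grad f x) (u x) ∂α + ∫ y, inner ℝ (grad g y) (v y) ∂β) (Set.Ioi 0) 0 := by
  have hcc := hc.continuous
  have hXm : MeasurableSet X := (isCompact_iff_compactSpace.2 inferInstance).measurableSet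
  have hgib := continuous_gibbs (γ := γ) hcc f.continuous g.continuous
  have mu := fun s => measurable_move hXm hu.measurable s
  have mv := fun s => measurable_move hXm hv.measurable s
  have muv : ∀ s, Measurable (fun z : X × X => (move u s z.1, move v s z.2)) := fun s =>
    (mu s).prodMap (mv s)
  obtain ⟨Bu, hBu⟩ := isCompact_univ.exists_bound_of_continuousOn hu.continuousOn
  obtain ⟨Bv, hBv⟩ := isCompact_univ.exists_bound_of_continuousOn hv.continuousOn
  obtain ⟨M, hM⟩ := isCompact_univ.exists_bound_of_continuousOn hgib.continuousOn
  have hM0 : 0 ≤ M := by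
    obtain ⟨x⟩ : Nonempty X := nonempty_of_isProbabilityMeasure α
    exact (norm_nonneg _).trans (hM (x, x) trivial)
  have du : ∀ s x, dist (move u s x) x ≤ Bu * |s| := fun s x =>
    (dist_move_le u s x).trans (by rw [mul_comm]; gcongr; exact hBu x trivial)
  have dv : ∀ s x, dist (move v s x) x ≤ Bv * |s| := fun s x =>
    (dist_move_le v s x).trans (by rw [mul_comm]; gcongr; exact hBv x trivial)
  -- As Sinkhorn images, the potentials inherit the Lipschitz constant of the cost.
  have fl : ∀ s x, |f (move u s x) - f x| ≤ |Gc| * (Bu * |s|) := fun s x => by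
    rw [hf, hf]
    exact (sinkhornMap_sub_le hγ hc g.continuous _ _).trans (by gcongr; exact du s x)
  have gl : ∀ s x, |g (move v s x) - g x| ≤ |Gc| * (Bv * |s|) := fun s x => by
    rw [hg, hg]
    exact (sinkhornMap_sub_le hγ hc f.continuous _ _).trans (by gcongr; exact dv s x)
  have cl : ∀ s x y, |c (move u s x) (move v s y) - c x y| ≤
      |Gc| * (Bu * |s|) + |Gc| * (Bv * |s|) := fun s x y => by
    have h1 := hc.abs_sub_le (move u s x) x (move v s y)
    have h2 := hc.abs_sub_le (move v s y) y x
    rw [hc.symm _ x, hc.symm y x] at h2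
    have h3 : |Gc| * dist (move u s x) x ≤ |Gc| * (Bu * |s|) := by gcongr; exact du s x
    have h4 : |Gc| * dist (move v s y) y ≤ |Gc| * (Bv * |s|) := by gcongr; exact dv s y
    calc _ = |(c (move u s x) (move v s y) - c x (move v s y)) +
          (c x (move v s y) - c x y)| := by ring_nf
      _ ≤ _ := abs_add_le _ _
      _ ≤ _ := by linarith
  have segae : ∀ᵐ z ∂(α.prod β), SegmentIn X u r z.1 ∧ SegmentIn X v r z.2 :=
    (Measure.quasiMeasurePreserving_fst.ae hαu).and (Measure.quasiMeasurePreserving_snd.ae hβv)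
  have hdf : ∀ x, HasGradientWithinAt (extZero f) (grad f x) X x := fun x => by
    rw [grad_potential_eq hXd hγ hc hf x]; exact hasGradientWithinAt_potential hXd hγ hc hf x
  have hdg : ∀ x, HasGradientWithinAt (extZero g) (grad g x) X x := fun x => by
    rw [grad_potential_eq hXd hγ hc hg x]; exact hasGradientWithinAt_potential hXd hγ hc hg x
  have cgf := continuous_grad_potential hXd hγ hc hf
  have cgg := continuous_grad_potential hXd hγ hc hg
  set Au := ∫ x, inner ℝ (grad f x) (u x) ∂α
  set Av := ∫ y, inner ℝ (grad g y) (v y) ∂β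
  have i1 := integrable_gibbs_mul_inner_costGrad (α := α) (β := β) (γ := γ) (f := f) (g := g)
    hXd hc hu
  have i2 := integrable_gibbs_mul_inner_costGrad_swap (α := α) (β := β) (γ := γ) (f := f) (g := g)
    hXd hc hv
  have e1 := integral_gibbs_mul_inner_costGrad (α := α) hXd hγ hc hf hu
  have e2 := integral_gibbs_mul_inner_costGrad_swap (β := β) hXd hγ hc hg hv
  -- the primal upper bound
  have hU : HasDerivWithinAt (fun s => ∫ z, gibbs γ c f g z * c (move u s z.1) (move v s z.2)
      ∂(α.prod β) + γ * ∫ z, InformationTheory.klFun (gibbs γ c f g z) ∂(α.prod β))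
      (Au + Av) (Set.Ioi 0) 0 := by
    refine HasDerivWithinAt.add_const _ ?_
    have h := hasDerivWithinAt_integral (μ := α.prod β)
      (G := fun s z => gibbs γ c f g z * c (move u s z.1) (move v s z.2))
      (G' := fun z => gibbs γ c f g z * inner ℝ (costGrad c z.1 z.2) (u z.1) +
        gibbs γ c f g z * inner ℝ (costGrad c z.2 z.1) (v z.2))
      (K := M * (|Gc| * Bu + |Gc| * Bv)) (fun s => ?_) (fun s z => ?_) ?_
    · rwa [integral_add i1 i2, e1, e2] at h
    · exact (integrable_comp_of_continuous hcc (muv s)).bdd_mul hgib.aestronglyMeasurable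
        (ae_of_all _ fun z => hM z trivial)
    · rw [move_zero, move_zero, ← mul_sub, abs_mul, mul_assoc]
      refine mul_le_mul (hM z trivial) ((cl s z.1 z.2).trans (by linarith)) (abs_nonneg _) hM0
    · filter_upwards [segae] with z hz
      simpa only [mul_add] using
        (hasDerivWithinAt_cost_move hc hr hz.1 hz.2).const_mul (gibbs γ c f g z)
  -- the dual lower bound
  have hL1 : HasDerivWithinAt (fun s => ∫ x, f (move u s x) ∂α) Au (Set.Ioi 0) 0 := by
    refine hasDerivWithinAt_integral (K := |Gc| * Bu)
      (fun s => integrable_comp_of_continuous f.continuous (mu s)) (fun s x => ?_) ?_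
    · rw [move_zero]
      linarith [fl s x]
    · filter_upwards [hαu] with x hx using hasDerivWithinAt_move_zero hr hx (hdf x)
  have hL2 : HasDerivWithinAt (fun s => ∫ y, g (move v s y) ∂β) Av (Set.Ioi 0) 0 := by
    refine hasDerivWithinAt_integral (K := |Gc| * Bv)
      (fun s => integrable_comp_of_continuous g.continuous (mv s)) (fun s x => ?_) ?_
    · rw [move_zero]
      linarith [gl s x]
    · filter_upwards [hβv] with x hx using hasDerivWithinAt_move_zero hr hx (hdg x)
  -- The marginals of the plan turn the `grad f` and `grad g` terms into `Au + Av`, and the cost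
  -- terms integrate to the same value, so the derivative vanishes.
  have hL3 : HasDerivWithinAt (fun s => ∫ z, (gibbs γ c f g (move u s z.1, move v s z.2) - 1)
      ∂(α.prod β)) 0 (Set.Ioi 0) 0 := by
    have hcu : Continuous fun x => inner ℝ (grad f x) (u x) := cgf.inner hu
    have hcv : Continuous fun x => inner ℝ (grad g x) (v x) := cgg.inner hv
    have j1 : Integrable (fun z : X × X => gibbs γ c f g z * inner ℝ (grad f z.1) (u z.1))
      (α.prod β) := integrable_of_continuous (by fun_prop)
    have j2 : Integrable (fun z : X × X => gibbs γ c f g z * inner ℝ (grad g z.2) (v z.2))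
      (α.prod β) := integrable_of_continuous (by fun_prop)
    have h := hasDerivWithinAt_integral (μ := α.prod β)
      (G := fun s z => gibbs γ c f g (move u s z.1, move v s z.2) - 1)
      (G' := fun z => (gibbs γ c f g z * inner ℝ (grad f z.1) (u z.1) +
        gibbs γ c f g z * inner ℝ (grad g z.2) (v z.2) -
        (gibbs γ c f g z * inner ℝ (costGrad c z.1 z.2) (u z.1) +
        gibbs γ c f g z * inner ℝ (costGrad c z.2 z.1) (v z.2))) / γ)
      -- The factor 2: the potentials and the cost each change the numerator of the exponent by at
      -- most `(|Gc| * Bu + |Gc| * Bv) * |s|`.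
      (K := M * ((2 * (|Gc| * Bu + |Gc| * Bv)) / γ)) (fun s => ?_) (fun s z => ?_) ?_
    · have j3 : Integrable (fun z : X × X => gibbs γ c f g z * inner ℝ (grad f z.1) (u z.1) +
        gibbs γ c f g z * inner ℝ (grad g z.2) (v z.2)) (α.prod β) := j1.add j2
      have i3 : Integrable (fun z : X × X =>
        gibbs γ c f g z * inner ℝ (costGrad c z.1 z.2) (u z.1) +
        gibbs γ c f g z * inner ℝ (costGrad c z.2 z.1) (v z.2)) (α.prod β) := i1.add i2
      rwa [integral_div, integral_sub j3 i3, integral_add i1 i2, integral_add j1 j2, e1, e2,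
        integral_gibbs_mul_left hγ hc hf hcu, integral_gibbs_mul_right hγ hc hg hcv, sub_self,
        zero_div] at h
    · exact (integrable_comp_of_continuous hgib (muv s)).sub (integrable_const _)
    · rw [move_zero, move_zero, sub_sub_sub_cancel_right, mul_assoc]
      refine (abs_exp_sub_exp_le ((le_abs_self _).trans (hM _ trivial))
        ((le_abs_self _).trans (hM _ trivial))).trans (mul_le_mul_of_nonneg_left ?_ hM0)
      rw [← sub_div, abs_div, abs_of_pos hγ, div_mul_eq_mul_div]
      gcongr
      have a1 := abs_le.1 (fl s z.1)
      have a2 := abs_le.1 (gl s z.2)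
      have a3 := abs_le.1 (cl s z.1 z.2)
      rw [abs_le]
      simp only
      constructor <;> linarith [a1.1, a1.2, a2.1, a2.2, a3.1, a3.2]
    · filter_upwards [segae] with z hz
      have d1 := hasDerivWithinAt_move_zero hr hz.1 (hdf z.1)
      have d2 := hasDerivWithinAt_move_zero hr hz.2 (hdg z.2)
      have d3 := hasDerivWithinAt_cost_move hc hr hz.1 hz.2
      have d4 := ((((d1.add d2).sub d3).div_const γ).exp).sub_const 1
      simp only [Pi.add_apply, Pi.sub_apply, move_zero] at d4
      refine d4.congr_deriv ?_
      simp only [gibbs]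
      ring
  have hL := (hL1.add hL2).sub (hL3.const_mul γ)
  rw [mul_zero, sub_zero] at hL
  have hprob : ∀ s, IsProbabilityMeasure (α.map (move u s)) ∧
      IsProbabilityMeasure (β.map (move v s)) := fun s =>
    ⟨Measure.isProbabilityMeasure_map (mu s).aemeasurable,
      Measure.isProbabilityMeasure_map (mv s).aemeasurable⟩
  have hup := fun s => OT_incl_map_le (α := α) (β := β) hγ hcc hc.symm hc.nonneg hf hg (mu s) (mv s)
  refine hasDerivWithinAt_of_squeeze (fun s => ?_) (fun s => ?_) ?_ hL hU
  · have := (hprob s).1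
    have := (hprob s).2
    have h1 := ofReal_dualObjective_le_OT (μ := α.map (move u s)) (ν := β.map (move v s))
      hγ hcc hc.nonneg (f, g)
    rw [dualObjective, integral_map (mu s).aemeasurable f.continuous.aestronglyMeasurable,
      integral_map (mv s).aemeasurable g.continuous.aestronglyMeasurable,
      Measure.map_prod_map _ _ (mu s) (mv s),
      integral_map ((mu s).prodMap (mv s)).aemeasurable
        (Continuous.aestronglyMeasurable (by fun_prop))] at h1
    exact (ENNReal.ofReal_le_iff_le_toReal ((hup s).trans_lt ENNReal.ofReal_lt_top).ne).1 h1
  · refine ENNReal.toReal_le_of_le_ofReal ?_ (hup s)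
    exact add_nonneg (integral_nonneg fun z => mul_nonneg (gibbs_pos _).le (hc.nonneg _ _))
      (mul_nonneg hγ.le (integral_nonneg fun z =>
        InformationTheory.klFun_nonneg (gibbs_pos _).le))
  -- At `s = 0` the two bounds agree: there is no duality gap.
  · simp only [Pi.add_apply, Pi.sub_apply, move_zero]
    rw [primal_gibbs_eq hγ hcc hc.symm hf hg, integral_sub (integrable_of_continuous hgib)
      (integrable_const _), integral_gibbs_eq_one hγ hcc hg]
    simp

end Envelope

/-! ### Potentials of a measure with itself. -/

section SelfTransport

variable {c : X → X → ℝ} {Mc Gc Lc γ : ℝ} [CompactSpace X] {α : Measure X}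
  [IsProbabilityMeasure α] {f g : C(X, ℝ)}

/-- The two Sinkhorn potentials of a measure with itself differ by a constant. -/
lemma exists_potential_eq_add_const (hγ : 0 < γ) (hc : CostAssumption c Mc Gc Lc)
    (hf : ∀ x, f x = sinkhornMap γ c g α x) (hg : ∀ y, g y = sinkhornMap γ c f α y) :
    ∃ t, ∀ x, f x = g x + t := by
  have hcc := hc.continuous
  have cfg := continuous_gibbs (γ := γ) hcc f.continuous g.continuous
  have cgf := continuous_gibbs (γ := γ) hcc g.continuous f.continuous
  have int : ∀ h : X × X → ℝ, Continuous h → Integrable h (α.prod α) :=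
    fun h hh => integrable_of_continuous hh
  set h : X → ℝ := fun x => f x - g x with hdef
  have hh : Continuous h := by fun_prop
  -- The two exponents differ by `(h z.1 - h z.2) / γ`, so `F` is nonnegative by monotonicity of
  -- `exp`. Both plans have marginals `α`, so it integrates to zero and `h` is constant a.e.
  set F : X × X → ℝ := fun z => (h z.1 - h z.2) * (gibbs γ c f g z - gibbs γ c g f z) with hF
  have hF0 : 0 ≤ F := by
    intro z
    simp only [hF, hdef, gibbs, Pi.zero_apply]
    rcases le_total (f z.1 - g z.1) (f z.2 - g z.2) with hle | hle
    · refine mul_nonneg_of_nonpos_of_nonpos (by linarith) (sub_nonpos.2 (Real.exp_le_exp.2 ?_))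
      exact div_le_div_of_nonneg_right (by linarith) hγ.le
    · refine mul_nonneg (by linarith) (sub_nonneg.2 (Real.exp_le_exp.2 ?_))
      exact div_le_div_of_nonneg_right (by linarith) hγ.le
  have hFi : ∫ z, F z ∂(α.prod α) = 0 := by
    have hexp : ∀ z, F z = (gibbs γ c f g z * h z.1 - gibbs γ c f g z * h z.2) -
        (gibbs γ c g f z * h z.1 - gibbs γ c g f z * h z.2) := fun z => by
      simp only [hF]; ring
    simp_rw [hexp]
    rw [integral_sub (int _ (by fun_prop)) (int _ (by fun_prop)),
      integral_sub (int _ (by fun_prop)) (int _ (by fun_prop)),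
      integral_sub (int _ (by fun_prop)) (int _ (by fun_prop)),
      integral_gibbs_mul_left hγ hc hf hh, integral_gibbs_mul_right hγ hc hg hh,
      integral_gibbs_mul_left hγ hc hg hh, integral_gibbs_mul_right hγ hc hf hh]
    ring
  have hae := (integral_eq_zero_iff_of_nonneg hF0 (int _ (by fun_prop))).1 hFi
  have hae' : ∀ᵐ z ∂(α.prod α), h z.1 = h z.2 := by
    filter_upwards [hae] with z hz
    rcases mul_eq_zero.1 hz with h0 | h0
    · linarith
    · have h1 := Real.exp_injective (sub_eq_zero.1 h0)
      rw [div_left_inj' hγ.ne'] at h1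
      simp only [hdef]
      linarith
  obtain ⟨x₀, hx₀⟩ := (Measure.ae_ae_of_ae_prod hae').exists
  refine ⟨h x₀, fun x => ?_⟩
  -- Inserting the a.e. identity `f = g + h x₀` into the equation for `g` makes it hold at every
  -- point.
  have h1 : g x = sinkhornMap γ c (fun y => g y - -h x₀) α x := by
    rw [hg]
    simp only [sinkhornMap]
    congr 2
    refine integral_congr_ae ?_
    filter_upwards [hx₀] with y hy
    rw [hy]
    simp only [hdef]
    ring_nf
  rw [sinkhornMap_sub_const α hγ hcc g.continuous, ← hf] at h1
  linarith

lemma grad_potential_self_eq (hXd : UniqueDiffOn ℝ X) (hγ : 0 < γ)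
    (hc : CostAssumption c Mc Gc Lc)
    (hf : ∀ x, f x = sinkhornMap γ c g α x) (hg : ∀ y, g y = sinkhornMap γ c f α y) (x : X) :
    grad g x = grad f x := by
  obtain ⟨t, ht⟩ := exists_potential_eq_add_const hγ hc hf hg
  rw [grad_potential_eq hXd hγ hc hf x]
  refine grad_eq_of_hasGradientWithinAt hXd ?_
  have h := (hasGradientWithinAt_potential hXd hγ hc hf x).hasFDerivWithinAt.sub_const t
  have hcongr : ∀ z ∈ X, extZero g z = extZero f z - t := fun z hz => by
    rw [extZero_of_mem _ hz, extZero_of_mem _ hz, ht]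
    ring
  exact h.congr hcongr (hcongr x x.2)

end SelfTransport

/-! ### Finiteness of the transport cost and one-sided limits. -/

section Finiteness

variable {c : X → X → ℝ} {Mc Gc Lc γ : ℝ} {α β : Measure X}

/-- A coupling of finite value gives no mass to the region where the cost is infinite. -/
lemma ae_mem_of_OT_ne_top (hX : MeasurableSet X) {μ ν : Measure (E d)} (h : OT γ c μ ν ≠ ∞) :
    ∀ᵐ x ∂μ, x ∈ X := by
  obtain ⟨π, hπ, hlt⟩ : ∃ π ∈ couplings μ ν, (∫⁻ z, extCost c z.1 z.2 ∂π) +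
      ENNReal.ofReal γ * InformationTheory.klDiv π (μ.prod ν) < ∞ := by
    simpa [OT, iInf_lt_iff, lt_top_iff_ne_top] using lt_top_iff_ne_top.2 h
  have hm : MeasurableSet {z : E d × E d | z.1 ∉ X} := measurable_fst hX.compl
  have h1 : ∞ * π {z : E d × E d | z.1 ∉ X} ≠ ∞ := by
    refine ne_top_of_le_ne_top (ENNReal.add_lt_top.1 hlt).1.ne ?_
    rw [← lintegral_indicator_const hm]
    refine lintegral_mono fun z => ?_
    by_cases hz : z.1 ∈ X
    · rw [Set.indicator_of_notMem (by simpa using hz)]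
      exact zero_le
    · rw [extCost, dif_neg fun h => hz h.1]
      exact le_top
  have h2 : π {z : E d × E d | z.1 ∉ X} = 0 := by
    by_contra hne
    exact h1 (ENNReal.top_mul hne)
  rw [← hπ.1, ae_iff]
  exact (Measure.fst_apply hX.compl).trans h2

lemma OT_incl_ne_top [IsProbabilityMeasure α] [IsProbabilityMeasure β] (hX : MeasurableSet X)
    (hc : CostAssumption c Mc Gc Lc) : OT γ c (incl α) (incl β) ≠ ∞ := by
  refine ne_top_of_le_ne_top ?_ (OT_incl_le hX (π := α.prod β) ?_ ?_)
  · rw [InformationTheory.klDiv_self, mul_zero, add_zero]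
    refine ne_top_of_le_ne_top (ENNReal.ofReal_ne_top (r := Mc)) ?_
    refine (lintegral_mono fun z : X × X => ENNReal.ofReal_le_ofReal (hc.bounded z.1 z.2)).trans ?_
    simp
  · rw [Measure.fst_prod]
  · rw [Measure.snd_prod]

/-- The null set in the hypothesis depends on `s`. A countable dense set of times gives a single
one, and closedness of `X` fills in the other times. -/
lemma ae_segmentIn (hX : IsClosed X) {u : X → E d} {r : ℝ}
    (h : ∀ s ∈ Set.Icc 0 r, ∀ᵐ x : X ∂α, (x : E d) + s • u x ∈ X) :
    ∀ᵐ x ∂α, SegmentIn X u r x := by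
  obtain ⟨Q, hQc, hQd⟩ := TopologicalSpace.exists_countable_dense (Set.Icc 0 r)
  have hQ : ∀ᵐ x : X ∂α, ∀ q ∈ Q, (x : E d) + (q : ℝ) • u x ∈ X :=
    (ae_ball_iff hQc).2 fun q _ => h q q.2
  filter_upwards [hQ] with x hx s hs
  have hcl : IsClosed {q : Set.Icc 0 r | (x : E d) + (q : ℝ) • u x ∈ X} :=
    hX.preimage (by fun_prop)
  have := hcl.closure_subset_iff.2 hx (hQd ⟨s, hs⟩)
  exact this

end Finiteness

/-- A functional whose one-sided directional derivatives at `0` are given by `D`, in every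
direction in which it is finite for a while, has `D` as its derivative at `0`. -/
lemma hasDerivRKHS_zero_of_right {V : Type*} [NormedAddCommGroup V] [InnerProductSpace ℝ V]
    {F : V → ℝ≥0∞} {D : V} (h0 : F 0 ≠ ∞)
    (h : ∀ ξ : V, ∀ r : ℝ, 0 < r → (∀ s ∈ Set.Icc 0 r, F (s • ξ) ≠ ∞) →
      HasDerivWithinAt (fun s : ℝ => (F (s • ξ)).toReal) (inner ℝ D ξ) (Set.Ioi 0) 0) :
    HasDerivRKHS F D 0 := by
  have h' : ∀ ξ : V, ∀ r : ℝ, 0 < r → (∀ s ∈ Set.Icc 0 r, F (s • ξ) ≠ ∞) →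
      Tendsto (fun s : ℝ => ((F (s • ξ)).toReal - (F 0).toReal) / s) (𝓝[>] 0)
        (𝓝 (inner ℝ D ξ)) := fun ξ r hr hF => by
    have h1 := h ξ r hr hF
    rw [hasDerivWithinAt_iff_tendsto_slope' (by simp)] at h1
    refine h1.congr fun s => ?_
    rw [slope_def_field, sub_zero, zero_smul]
  refine ⟨h0, fun ξ => ?_⟩
  simp only [zero_add]
  set S : Set ℝ := {ε | ε ≠ 0 ∧ ∀ s ∈ Set.uIcc 0 ε, F (s • ξ) ≠ ∞} with hS
  -- On each side either no `ε` is admissible and the filter is trivial, or one admissible `ε` gives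
  -- a whole segment of finiteness. The negative side is the positive one for `-ξ`.
  have hsplit : S = (S ∩ Set.Ioi 0) ∪ (S ∩ Set.Iio 0) := by
    ext ε
    refine ⟨fun hε => ?_, by rintro (hε | hε) <;> exact hε.1⟩
    rcases lt_or_gt_of_ne hε.1 with h1 | h1
    exacts [Or.inr ⟨hε, h1⟩, Or.inl ⟨hε, h1⟩]
  rw [hsplit, nhdsWithin_union]
  refine Tendsto.sup ?_ ?_
  · rcases (S ∩ Set.Ioi 0).eq_empty_or_nonempty with he | ⟨r, hr, hr0⟩
    · rw [he, nhdsWithin_empty]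
      exact tendsto_bot
    · refine (h' ξ r hr0 ?_).mono_left (nhdsWithin_mono _ Set.inter_subset_right)
      rw [← Set.uIcc_of_le (le_of_lt hr0)]
      exact hr.2
  · rcases (S ∩ Set.Iio 0).eq_empty_or_nonempty with he | ⟨r, hr, hr0⟩
    · rw [he, nhdsWithin_empty]
      exact tendsto_bot
    · have hr0' : r < 0 := hr0
      have h1 := h' (-ξ) (-r) (neg_pos.2 hr0') fun s hs => by
        have := hr.2 (-s) (by
          rw [Set.uIcc_of_ge hr0'.le]
          exact ⟨by linarith [hs.2], by linarith [hs.1]⟩)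
        simpa using this
      have hneg : Tendsto (fun s : ℝ => -s) (𝓝[<] 0) (𝓝[>] 0) := by
        simpa using tendsto_neg_nhdsLT (a := (0 : ℝ))
      have h2 := (h1.comp hneg).neg
      rw [inner_neg_right, neg_neg] at h2
      refine Tendsto.mono_left (h2.congr fun s => ?_)
        (nhdsWithin_mono _ Set.inter_subset_right)
      simp only [Function.comp_apply, smul_neg, neg_smul, neg_neg, div_neg]

/-! ### Evaluation and kernel embeddings in the RKHS. -/

section Kernel

variable {H : Type*} [NormedAddCommGroup H] [InnerProductSpace ℝ H] [RKHS ℝ H X ℝ]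

lemma eval_apply (ψ : Hd H d) (x : X) (i : Fin d) : eval ψ x i = ψ i x := rfl

lemma eval_smul (a : ℝ) (ψ : Hd H d) (x : X) : eval (a • ψ) x = a • eval ψ x := by
  ext i
  simp [eval_apply]

lemma eval_zero (x : X) : eval (0 : Hd H d) x = 0 := by
  ext i
  simp [eval_apply]

lemma push_zero {α : Measure X} : push (0 : Hd H d) α = incl α := by
  simp only [push, incl, eval_zero, add_zero]

variable [CompleteSpace H] {Dk Gk : ℝ}

variable (H) in
/-- The kernel section `k(·, x)`. -/
noncomputable def kerSection (x : X) : H := RKHS.kerFun H x 1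

lemma inner_kerSection (x : X) (h : H) : inner ℝ (kerSection H x) h = h x := by
  rw [kerSection, RKHS.kerFun_inner]
  simp

lemma ker_eq_inner (x y : X) : ker H x y = inner ℝ (kerSection H x) (kerSection H y) := by
  rw [inner_kerSection, kerSection, RKHS.kerFun_apply, ker]

/-- The squared distance of two sections is `k(y,y) - 2 k(x,y) + k(x,x)`, two increments of the
kernel in one argument, so sections are 1/2-Hölder. -/
lemma continuous_kerSection (hk : KernelAssumption H Dk Gk) :
    Continuous (kerSection H : X → H) := by
  rw [continuous_iff_continuousAt]
  intro x
  rw [ContinuousAt, tendsto_iff_norm_sub_tendsto_zero]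
  have hb : ∀ y, ‖kerSection H y - kerSection H x‖ ≤ Real.sqrt (2 * (Gk * ‖(y : E d) - x‖)) := by
    intro y
    refine Real.le_sqrt_of_sq_le ?_
    have h1 := (abs_le.1 (hk.lipschitz y x y)).2
    have h2 := (abs_le.1 (hk.lipschitz y x x)).1
    rw [← real_inner_self_eq_norm_sq, inner_sub_left, inner_sub_right, inner_sub_right,
      ← ker_eq_inner, ← ker_eq_inner, ← ker_eq_inner, ← ker_eq_inner]
    linarith
  refine squeeze_zero (fun y => norm_nonneg _) hb ?_
  have : Tendsto (fun y : X => Real.sqrt (2 * (Gk * ‖(y : E d) - x‖))) (𝓝 x)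
      (𝓝 (Real.sqrt (2 * (Gk * ‖(x : E d) - x‖)))) := Continuous.tendsto (by fun_prop) x
  simpa using this

lemma continuous_ker (hk : KernelAssumption H Dk Gk) (y : X) :
    Continuous (fun x => ker H x y) := by
  simp only [ker_eq_inner]
  exact (continuous_kerSection hk).inner continuous_const

lemma continuous_eval (hk : KernelAssumption H Dk Gk) (ψ : Hd H d) :
    Continuous (eval ψ : X → E d) := by
  refine (PiLp.continuous_toLp 2 _).comp (continuous_pi fun i => ?_)
  simp only [← inner_kerSection]
  exact (continuous_kerSection hk).inner continuous_const

lemma norm_eval_le {B : ℝ} (hB : ∀ x : X, ‖kerSection H x‖ ≤ B) (ψ : Hd H d) (x : X) :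
    ‖eval ψ x‖ ≤ B * ‖ψ‖ := by
  have hB0 : 0 ≤ B := (norm_nonneg _).trans (hB x)
  refine le_of_sq_le_sq ?_ (by positivity)
  rw [mul_pow, EuclideanSpace.norm_sq_eq, PiLp.norm_sq_eq_of_L2, Finset.mul_sum]
  refine Finset.sum_le_sum fun i _ => ?_
  rw [← mul_pow]
  gcongr
  rw [eval_apply, ← inner_kerSection]
  exact (norm_inner_le_norm _ _).trans (by gcongr; exact hB x)

/-- The kernel embedding of a continuous vector field. -/
lemma exists_kernel_embedding [CompactSpace X] (hk : KernelAssumption H Dk Gk) {α : Measure X}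
    [IsFiniteMeasure α] {p : X → E d} (hp : Continuous p) : ∃ D : Hd H d,
      (∀ y : X, Integrable (fun x => ker H x y • p x) α ∧
        eval D y = ∫ x, ker H x y • p x ∂α) ∧
      ∀ ξ : Hd H d, inner ℝ D ξ = ∫ x, inner ℝ (p x) (eval ξ x) ∂α := by
  have hpi : ∀ i, Continuous fun x => p x i := fun i => by fun_prop
  have hint : ∀ i, Integrable (fun x => p x i • kerSection H x) α := fun i =>
    integrable_of_continuous ((hpi i).smul (continuous_kerSection hk))
  -- Each component is a Bochner integral in `H`; inner products, and hence point evaluations, pass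
  -- under it.
  refine ⟨WithLp.toLp 2 fun i => ∫ x, p x i • kerSection H x ∂α, fun y => ?_, fun ξ => ?_⟩
  · have h1 : Integrable (fun x => ker H x y • p x) α :=
      integrable_of_continuous ((continuous_ker hk y).smul hp)
    refine ⟨h1, ?_⟩
    ext i
    have h2 : ∫ x, (ker H x y • p x) i ∂α = (∫ x, ker H x y • p x ∂α) i :=
      (EuclideanSpace.proj (𝕜 := ℝ) i : E d →L[ℝ] ℝ).integral_comp_comm h1
    rw [← h2, eval_apply]
    change (∫ x, p x i • kerSection H x ∂α : H) y = _
    rw [← inner_kerSection, ← integral_inner (𝕜 := ℝ) (hint i)]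
    refine integral_congr_ae (ae_of_all _ fun x => ?_)
    simp only [real_inner_smul_right, ker_eq_inner, PiLp.smul_apply, smul_eq_mul]
    rw [real_inner_comm, mul_comm]
  · rw [PiLp.inner_apply]
    have h3 : ∀ x, inner ℝ (p x) (eval ξ x) = ∑ i, p x i * ξ i x := fun x => by
      simp [PiLp.inner_apply, eval_apply, mul_comm]
    simp only [h3]
    have hxi : ∀ i, Continuous fun x => ξ i x := fun i => by
      simp only [← inner_kerSection]
      exact (continuous_kerSection hk).inner continuous_const
    have hpx : ∀ i, Integrable (fun x => p x i * ξ i x) α := fun i =>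
      integrable_of_continuous ((hpi i).mul (hxi i))
    rw [integral_finsetSum _ fun i _ => hpx i]
    refine Finset.sum_congr rfl fun i _ => ?_
    change inner ℝ (∫ x, p x i • kerSection H x ∂α) (ξ i) = _
    rw [real_inner_comm, ← integral_inner (𝕜 := ℝ) (hint i)]
    refine integral_congr_ae (ae_of_all _ fun x => ?_)
    simp only [real_inner_smul_right]
    rw [real_inner_comm, inner_kerSection]

end Kernel

/-! ### Derivatives of the two functionals. -/

section Functionals

variable {c : X → X → ℝ} {Mc Gc Lc γ : ℝ} {α β : Measure X} {H : Type*} [NormedAddCommGroup H]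
  [InnerProductSpace ℝ H] [CompleteSpace H] [RKHS ℝ H X ℝ] {Dk Gk : ℝ}

/-- The truncation in `move` acts only on a null set, so the push-forward in the ambient space comes
from one inside `X`. -/
lemma push_smul_eq_incl_map (hX : MeasurableSet X) (hk : KernelAssumption H Dk Gk)
    {ξ : Hd H d} {s : ℝ} (h : ∀ᵐ x : X ∂α, (x : E d) + s • eval ξ x ∈ X) :
    push (s • ξ) α = incl (α.map (move (eval ξ) s)) := by
  rw [incl, Measure.map_map measurable_subtype_coe
    (measurable_move hX (continuous_eval hk ξ).measurable s), push]
  refine Measure.map_congr ?_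
  filter_upwards [h] with x hx
  rw [Function.comp_apply, move_of_mem hx, eval_smul]

lemma ae_add_eval_mem_of_push (hX : MeasurableSet X) (hk : KernelAssumption H Dk Gk)
    {ψ : Hd H d} (h : ∀ᵐ x ∂(push ψ α), x ∈ X) : ∀ᵐ x : X ∂α, (x : E d) + eval ψ x ∈ X := by
  have hm : Measurable (fun x : X => (x : E d) + eval ψ x) :=
    measurable_subtype_coe.add (continuous_eval hk ψ).measurable
  exact (ae_map_iff hm.aemeasurable hX).1 h

lemma move_zero_field (s : ℝ) : move (fun _ : X => (0 : E d)) s = id := by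
  funext x
  rw [move_of_mem (by simp)]
  simp

variable [CompactSpace X] [IsProbabilityMeasure α] [IsProbabilityMeasure β] {f g : C(X, ℝ)}

lemma hasDerivRKHS_F₁ (hXd : UniqueDiffOn ℝ X) (hγ : 0 < γ)
    (hc : CostAssumption c Mc Gc Lc) (hk : KernelAssumption H Dk Gk)
    (hf : ∀ x, f x = sinkhornMap γ c g β x) (hg : ∀ y, g y = sinkhornMap γ c f α y)
    {D : Hd H d} (hD : ∀ ξ : Hd H d, inner ℝ D ξ = ∫ x, inner ℝ (grad f x) (eval ξ x) ∂α) :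
    HasDerivRKHS (F₁ γ c α β) D 0 := by
  have hXc : IsCompact X := isCompact_iff_compactSpace.2 inferInstance
  have hXm := hXc.measurableSet
  refine hasDerivRKHS_zero_of_right ?_ fun ξ r hr hfin => ?_
  · rw [F₁, push_zero]
    exact OT_incl_ne_top hXm hc
  have hae : ∀ s ∈ Set.Icc 0 r, ∀ᵐ x : X ∂α, (x : E d) + s • eval ξ x ∈ X := fun s hs => by
    simpa only [eval_smul] using
      ae_add_eval_mem_of_push hXm hk (ae_mem_of_OT_ne_top hXm (hfin s hs))
  have h1 := hasDerivWithinAt_OT_move hXd hγ hc hf hg (continuous_eval hk ξ)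
    (continuous_const (y := (0 : E d))) hr (ae_segmentIn hXc.isClosed hae)
    (ae_of_all _ fun x s _ => by simp)
  simp only [inner_zero_right, integral_zero, add_zero, move_zero_field, Measure.map_id,
    ← hD] at h1
  have hcongr : ∀ s ∈ Set.Icc 0 r, (F₁ γ c α β (s • ξ)).toReal =
      (OT γ c (incl (α.map (move (eval ξ) s))) (incl β)).toReal := fun s hs => by
    rw [F₁, push_smul_eq_incl_map hXm hk (hae s hs)]
  refine h1.congr_of_eventuallyEq ?_ (hcongr 0 ⟨le_rfl, hr.le⟩)
  filter_upwards [Ioc_mem_nhdsGT hr] with s hs using hcongr s ⟨hs.1.le, hs.2⟩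

/-- Both marginals move along the same field and the two potentials have equal gradients, so the
envelope formula gives the same integral twice. -/
lemma hasDerivRKHS_F₂ (hXd : UniqueDiffOn ℝ X) (hγ : 0 < γ)
    (hc : CostAssumption c Mc Gc Lc) (hk : KernelAssumption H Dk Gk)
    (hf : ∀ x, f x = sinkhornMap γ c g α x) (hg : ∀ y, g y = sinkhornMap γ c f α y)
    {D : Hd H d} (hD : ∀ ξ : Hd H d, inner ℝ D ξ = ∫ x, inner ℝ (grad f x) (eval ξ x) ∂α) :
    HasDerivRKHS (F₂ γ c α) ((2 : ℝ) • D) 0 := by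
  have hXc : IsCompact X := isCompact_iff_compactSpace.2 inferInstance
  have hXm := hXc.measurableSet
  refine hasDerivRKHS_zero_of_right ?_ fun ξ r hr hfin => ?_
  · rw [F₂, push_zero]
    exact OT_incl_ne_top hXm hc
  have hae : ∀ s ∈ Set.Icc 0 r, ∀ᵐ x : X ∂α, (x : E d) + s • eval ξ x ∈ X := fun s hs => by
    simpa only [eval_smul] using
      ae_add_eval_mem_of_push hXm hk (ae_mem_of_OT_ne_top hXm (hfin s hs))
  have hseg := ae_segmentIn hXc.isClosed hae
  have h1 := hasDerivWithinAt_OT_move hXd hγ hc hf hg (continuous_eval hk ξ)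
    (continuous_eval hk ξ) hr hseg hseg
  simp only [grad_potential_self_eq hXd hγ hc hf hg, ← hD, ← two_mul] at h1
  rw [real_inner_smul_left]
  have hcongr : ∀ s ∈ Set.Icc 0 r, (F₂ γ c α (s • ξ)).toReal =
      (OT γ c (incl (α.map (move (eval ξ) s))) (incl (α.map (move (eval ξ) s)))).toReal :=
    fun s hs => by rw [F₂, push_smul_eq_incl_map hXm hk (hae s hs)]
  refine h1.congr_of_eventuallyEq ?_ (hcongr 0 ⟨le_rfl, hr.le⟩)
  filter_upwards [Ioc_mem_nhdsGT hr] with s hs using hcongr s ⟨hs.1.le, hs.2⟩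

/-- The compact support has a `δ`-neighbourhood inside the interior of `X`, and `eval ψ` is
uniformly smaller than `δ` once `ψ` is small in norm. -/
lemma eventually_functionals_ne_top (hc : CostAssumption c Mc Gc Lc)
    (hk : KernelAssumption H Dk Gk) (hα : ∀ x ∈ α.support, (x : E d) ∈ interior X) :
    ∀ᶠ ψ : Hd H d in 𝓝 0, F₁ γ c α β ψ ≠ ∞ ∧ F₂ γ c α ψ ≠ ∞ := by
  have hXc : IsCompact X := isCompact_iff_compactSpace.2 inferInstance
  have hXm := hXc.measurableSet
  have hK : IsCompact (((↑) : X → E d) '' α.support) :=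
    (Measure.isClosed_support.isCompact).image continuous_subtype_val
  obtain ⟨δ, hδ, hδX⟩ := hK.exists_thickening_subset_open isOpen_interior
    (by rintro _ ⟨x, hx, rfl⟩; exact hα x hx)
  obtain ⟨B, hB⟩ := isCompact_univ.exists_bound_of_continuousOn
    (continuous_kerSection hk).continuousOn
  have hsmall : ∀ᶠ ψ : Hd H d in 𝓝 0, B * ‖ψ‖ < δ := by
    have : Tendsto (fun ψ : Hd H d => B * ‖ψ‖) (𝓝 0) (𝓝 (B * ‖(0 : Hd H d)‖)) :=
      Continuous.tendsto (by fun_prop) 0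
    rw [norm_zero, mul_zero] at this
    exact this.eventually (gt_mem_nhds hδ)
  filter_upwards [hsmall] with ψ hψ
  have hae : ∀ᵐ x : X ∂α, (x : E d) + (1 : ℝ) • eval ψ x ∈ X := by
    filter_upwards [Measure.support_mem_ae (μ := α)] with x hx
    refine interior_subset (hδX (Metric.mem_thickening_iff.2 ⟨x, ⟨x, hx, rfl⟩, ?_⟩))
    rw [dist_eq_norm, add_sub_cancel_left, one_smul]
    exact (norm_eval_le (fun x => hB x trivial) ψ x).trans_lt hψ
  have hpush := push_smul_eq_incl_map hXm hk hae
  rw [one_smul] at hpush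
  have : IsProbabilityMeasure (α.map (move (eval ψ) 1)) := Measure.isProbabilityMeasure_map
    (measurable_move hXm (continuous_eval hk ψ).measurable 1).aemeasurable
  rw [F₁, F₂, hpush]
  exact ⟨OT_incl_ne_top hXm hc, OT_incl_ne_top hXm hc⟩

end Functionals

end SinkhornDescent

/-! ### Assembly of the main theorem. -/

theorem mainTheorem4 {d : ℕ} {X : Set (SinkhornDescent.E d)} (hX : IsCompact X)
    (hXd : UniqueDiffOn ℝ X)
    {c : X → X → ℝ} {Mc Gc Lc : ℝ} (hc : SinkhornDescent.CostAssumption c Mc Gc Lc)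
    {H : Type*} [NormedAddCommGroup H] [InnerProductSpace ℝ H] [CompleteSpace H]
    [RKHS ℝ H X ℝ] {Dk Gk : ℝ} (hk : SinkhornDescent.KernelAssumption H Dk Gk)
    {γ : ℝ} (hγ : 0 < γ)
    (α β : Measure X) [IsProbabilityMeasure α] [IsProbabilityMeasure β] :
    -- Sinkhorn potentials exist
    (∃ f g, SinkhornDescent.IsSinkhornPotentials γ c α β f g) ∧
    (∃ f g, SinkhornDescent.IsSinkhornPotentials γ c α α f g) ∧
    -- the derivative of `F₁` at `0`
    (∀ f g, SinkhornDescent.IsSinkhornPotentials γ c α β f g →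
      (∀ x, SinkhornDescent.DiffAt f x) ∧
      ∃ D : SinkhornDescent.Hd H d,
        (∀ y : X,
          Integrable (fun x => SinkhornDescent.ker H x y • SinkhornDescent.grad f x) α ∧
          SinkhornDescent.eval D y =
            ∫ x, SinkhornDescent.ker H x y • SinkhornDescent.grad f x ∂α) ∧
        SinkhornDescent.HasDerivRKHS (SinkhornDescent.F₁ γ c α β) D 0) ∧
    -- the derivative of `F₂` at `0`
    (∀ f g, SinkhornDescent.IsSinkhornPotentials γ c α α f g →
      (∀ x, SinkhornDescent.DiffAt f x) ∧
      ∃ D : SinkhornDescent.Hd H d,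
        (∀ y : X,
          Integrable (fun x => SinkhornDescent.ker H x y • SinkhornDescent.grad f x) α ∧
          SinkhornDescent.eval D y =
            (2 : ℝ) • ∫ x, SinkhornDescent.ker H x y • SinkhornDescent.grad f x ∂α) ∧
        SinkhornDescent.HasDerivRKHS (SinkhornDescent.F₂ γ c α) D 0) ∧
    -- if `supp α` lies in the interior of `X`, both functionals are finite near `0`, so that the
    -- limits above are unrestricted two-sided limits in every direction
    ((∀ x ∈ α.support, (x : SinkhornDescent.E d) ∈ interior X) →
      ∀ᶠ ψ : SinkhornDescent.Hd H d in 𝓝 0,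
        SinkhornDescent.F₁ γ c α β ψ ≠ ∞ ∧ SinkhornDescent.F₂ γ c α ψ ≠ ∞) := by
  have hcs : CompactSpace X := isCompact_iff_compactSpace.1 hX
  have hex : ∀ (μ ν : Measure X) [IsProbabilityMeasure μ] [IsProbabilityMeasure ν],
      ∃ f g, SinkhornDescent.IsSinkhornPotentials γ c μ ν f g := fun μ ν _ _ => by
    obtain ⟨f, g, hf, hg⟩ := SinkhornDescent.exists_sinkhorn_fixedPoint μ ν hγ hc
    exact ⟨f, g, SinkhornDescent.isSinkhornPotentials_of_fixedPoint hγ hc.continuous hc.symm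
      hc.nonneg hf hg⟩
  refine ⟨hex α β, hex α α, fun f g h => ?_, fun f g h => ?_,
    SinkhornDescent.eventually_functionals_ne_top hc hk⟩
  · obtain ⟨D, hD, hDi⟩ := SinkhornDescent.exists_kernel_embedding (α := α) hk
      (SinkhornDescent.continuous_grad_potential hXd hγ hc h.left_eq)
    exact ⟨fun x => (SinkhornDescent.hasGradientWithinAt_potential hXd hγ hc h.left_eq
      x).differentiableWithinAt, D, hD,
      SinkhornDescent.hasDerivRKHS_F₁ hXd hγ hc hk h.left_eq h.right_eq hDi⟩
  · obtain ⟨D, hD, hDi⟩ := SinkhornDescent.exists_kernel_embedding (α := α) hk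
      (SinkhornDescent.continuous_grad_potential hXd hγ hc h.left_eq)
    refine ⟨fun x => (SinkhornDescent.hasGradientWithinAt_potential hXd hγ hc h.left_eq
      x).differentiableWithinAt, (2 : ℝ) • D, fun y => ⟨(hD y).1, ?_⟩,
      SinkhornDescent.hasDerivRKHS_F₂ hXd hγ hc hk h.left_eq h.right_eq hDi⟩
    rw [SinkhornDescent.eval_smul, (hD y).2]
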